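/- A \emph{coloured graph} $G=(V,w)$ consists of a finite vertex set $V$ and a symmetric function $w\colon V^2\to\{0,1,2\}$ with $w(x,x)=0$ for all $x\in V$; the edge between two distinct vertices $x,y$ is called green, blue, or red if $w(x,y)$ is $0$, $1$, or $2$, respectively. The degree of $x$ is $d(x)=\sum_{y\in V}w(x,y)$, and $\delta(G)=\min_{x\in V}d(x)$. A subgraph of $G$ is a coloured graph $(V',w')$ with $V'\subseteq V$ and $w'(x,y)\le w(x,y)$ for all $x,y\in V'$; $G$ is $F$-free if it has no subgraph isomorphic to $F$, and $\mathscr F$-free if it is $F$-free for every $F\in\mathscr F$. A homomorphism from $(V,w)$ to $(V',w')$ is a map $\varphi\colon V\to V'$ with $w(x,y)\le w'(\varphi(x),\varphi(y))$ for all distinct $x,y\in V$. For integers $a\ge b\ge 1$ let $G_{a+b,b}$ be the coloured graph of order $a$ consisting of a red clique on $b$ vertices and a blue clique on $a-b$ vertices that are connected to each other by blue edges, and let $\mathscr F_t=\{G_{t,i}\colon 1\le i\le t/2\}$. For $r\ge 2$ let $RK_r^-$ be the red clique on $r$ vertices with one edge recoloured blue. \textbf{Theorem.} Let $r\ge 3$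 be an integer. (1) If $G$ is an $\mathscr F_{2r}$-free coloured graph on $n$ vertices with $\delta(G)>\frac{14r-24}{7r-5}\,n$, then there is a homomorphism from $G$ to $RK_r^-$. In other words, there is a partition $V(G)=W_1\mathbin{\dot\cup}\dots\mathbin{\dot\cup}W_r$ (into possibly empty classes) such that all edges within the classes are green and no edge from $W_1$ to $W_2$ is red; for every coloured graph, the existence of such a partition is equivalent to the existence of a homomorphism to $RK_r^-$. (2) The constant is optimal: for every positive multiple $n$ of $7r-5$ there is an $\mathscr F_{2r}$-free coloured graph $G$ on $n$ vertices with $\delta(G)=\frac{14r-24}{7r-5}\,n$ that has no homomorphism to $RK_r^-$. Consequently $\frac{14r-24}{7r-5}$ is the least real number $\alpha$ such that every $\mathscr F_{2r}$-free coloured graph $G$ on $n$ vertices with $\delta(G)>\alpha n$ has a homomorphism to $RK_r^-$. -/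

import Mathlib

/-- A coloured graph on `V`: a weighted graph with weights in `{0, 1, 2}`. Distinct vertices
`x, y` are joined by a green, blue or red edge according to whether `w x y` is `0`, `1` or `2`. -/
structure ColouredGraph (V : Type*) where
  w : V → V → ℕ
  symm : ∀ x y, w x y = w y x
  loopless : ∀ x, w x x = 0
  le_two : ∀ x y, w x y ≤ 2

namespace ColouredGraph

/-- `H`, whose vertex set is the subset `S` of `V`, is a subgraph of `G`. -/
def IsSubgraph {V : Type*} {S : Set V} (H : ColouredGraph S) (G : ColouredGraph V) : Prop :=
  ∀ x y : S, H.w x y ≤ G.w x y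

/-- `F` and `H` are isomorphic. -/
def Isomorphic {U V : Type*} (F : ColouredGraph U) (H : ColouredGraph V) : Prop :=
  ∃ φ : U ≃ V, ∀ x y, F.w x y = H.w (φ x) (φ y)

/-- `G` is `F`-free: no subgraph of `G` is isomorphic to `F`. -/
def Free {U V : Type*} (F : ColouredGraph U) (G : ColouredGraph V) : Prop :=
  ¬ ∃ (S : Set V) (H : ColouredGraph S), H.IsSubgraph G ∧ F.Isomorphic H

/-- `G` is `𝓕`-free for a set `𝓕` of (finite) coloured graphs. -/
def FamilyFree {V : Type*} (𝓕 : Set (Σ m : ℕ, ColouredGraph (Fin m)))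
    (G : ColouredGraph V) : Prop :=
  ∀ F ∈ 𝓕, Free F.2 G

/-- The coloured graph `G_{a+b,b}` of order `a`: a red clique on the first `b` vertices, a blue
clique on the other `a - b` vertices, and blue edges between the two. -/
def cliqueGraph (a b : ℕ) : ColouredGraph (Fin a) where
  w x y := if x = y then 0 else if x.val < b ∧ y.val < b then 2 else 1
  symm x y := by simp only [eq_comm (a := x), and_comm (a := x.val < b)]
  loopless x := by simp
  le_two x y := by split_ifs <;> omega

/-- The family `𝓕_t = {G_{t,i} : 1 ≤ i ≤ t/2}`, where `G_{t,i} = G_{a+b,b}` with `b = i` and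
`a + b = t`. -/
def family (t : ℕ) : Set (Σ m : ℕ, ColouredGraph (Fin m)) :=
  {F | ∃ a b : ℕ, 1 ≤ b ∧ b ≤ a ∧ a + b = t ∧ F = ⟨a, cliqueGraph a b⟩}

/-- `RK_r⁻` (for `r ≥ 2`): the red clique on `r` vertices with the edge between the vertices
`0` and `1` recoloured blue. -/
def redCliqueMinus (r : ℕ) : ColouredGraph (Fin r) where
  w x y := if x = y then 0 else if x.val < 2 ∧ y.val < 2 then 1 else 2
  symm x y := by simp only [eq_comm (a := x), and_comm (a := x.val < 2)]
  loopless x := by simp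
  le_two x y := by split_ifs <;> omega

/-- The degree of a vertex. -/
def degree {V : Type*} [Fintype V] (G : ColouredGraph V) (x : V) : ℕ :=
  ∑ y, G.w x y

/-- The minimum degree (`0` if there are no vertices). -/
noncomputable def minDegree {V : Type*} [Fintype V] (G : ColouredGraph V) : ℕ :=
  ⨅ x, G.degree x

/-- `φ` is a homomorphism from `G` to `H`. -/
def IsHom {U V : Type*} (G : ColouredGraph U) (H : ColouredGraph V) (φ : U → V) : Prop :=
  ∀ x y, x ≠ y → G.w x y ≤ H.w (φ x) (φ y)

/-- There is a homomorphism from `G` to `H`. -/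
def HasHom {U V : Type*} (G : ColouredGraph U) (H : ColouredGraph V) : Prop :=
  ∃ φ : U → V, G.IsHom H φ

/-- The classes `W 0, …, W (r - 1)` are disjoint with union `V`, all edges inside a class are
green, and no edge from `W 0` to `W 1` is red. -/
def IsMinusPartition {V : Type*} (G : ColouredGraph V) {r : ℕ} (W : Fin r → Set V) : Prop :=
  (∀ i j, i ≠ j → Disjoint (W i) (W j)) ∧
  (⋃ i, W i) = Set.univ ∧
  (∀ i, ∀ x ∈ W i, ∀ y ∈ W i, x ≠ y → G.w x y = 0) ∧
  (∀ i j : Fin r, i.val = 0 → j.val = 1 → ∀ x ∈ W i, ∀ y ∈ W j, G.w x y ≠ 2)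

end ColouredGraph

/-!
Give all vertices the same mass, normalised to total `7r - 5`, and measure an edge by its gap
`2 - w`. The degree condition then says that every vertex has total gap less than `14`.

A minimiser of the quadratic form of the gaps on the simplex whose support is as small as possible
is supported on a clique without green edges. Comparing its total weight with the bound on cliques
produces a copy of `RK_r⁻`. Counting gaps against such a copy shows that almost all vertices are
twins of one of its vertices, and that the twin classes are large; replacing the vertices of a copy
by twins that are better joined to a given vertex shows that every vertex lies on a copy of `RK_r⁻`.

The vertices whose green neighbourhood has mass more than `6` are those which lie off the blue edge
of some copy. Twin classes split them into `r - 2` green classes. The remaining vertices span no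
red edge and no triangle without green edges, and their total mass is so large that their nongreen
degrees exceed `2/5` of it; by the theorem of Andrásfai, Erdős and Sós they split into two green
classes, which become `W₁` and `W₂`.

For the optimality, blow up a graph containing two copies of `RK_r⁻` such that some vertex is on
the blue edge of one copy and off the blue edge of the other. A homomorphism to `RK_r⁻` maps each
copy bijectively and preserves its blue edge, so it cannot exist.
-/

open Finset

/-! ### Quadratic forms on the standard simplex -/

section QuadraticForm

open Matrix

variable {V : Type*} [Fintype V] {M : Matrix V V ℝ} {p : V → ℝ}

theorem dotProduct_mulVec_add_smul_single_sub_single [DecidableEq V] (hM : M.IsSymm) (p : V → ℝ)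
    (x y : V) (t : ℝ) :
    (p + t • (Pi.single x 1 - Pi.single y 1)) ⬝ᵥ
        (M *ᵥ (p + t • (Pi.single x 1 - Pi.single y 1))) =
      p ⬝ᵥ (M *ᵥ p) + 2 * t * ((M *ᵥ p) x - (M *ᵥ p) y)
        + t ^ 2 * (M x x + M y y - 2 * M x y) := by
  have hsymm (u v : V → ℝ) : u ⬝ᵥ (M *ᵥ v) = v ⬝ᵥ (M *ᵥ u) := by
    rw [dotProduct_mulVec, ← mulVec_transpose, hM.eq, dotProduct_comm]
  rw [mulVec_add, dotProduct_add, add_dotProduct, add_dotProduct, hsymm p (t • _), mulVec_smul]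
  simp only [smul_dotProduct, dotProduct_smul, sub_dotProduct, single_dotProduct, mulVec_sub,
    Pi.sub_apply, mulVec_single, smul_eq_mul, one_mul, col_apply, MulOpposite.op_one, one_smul,
    hM.apply x y]
  ring

theorem add_smul_single_sub_single_mem_stdSimplex [DecidableEq V] (hp : p ∈ stdSimplex ℝ V)
    {x y : V} (hxy : x ≠ y) {t : ℝ} (hx : -p x ≤ t) (hy : t ≤ p y) :
    p + t • (Pi.single x 1 - Pi.single y 1) ∈ stdSimplex ℝ V := by
  refine ⟨fun z => ?_, by simp [sum_add_distrib, ← mul_sum, hp.2]⟩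
  rcases eq_or_ne z x with rfl | hzx
  · simpa [hxy] using neg_le_iff_add_nonneg'.1 hx
  rcases eq_or_ne z y with rfl | hzy
  · simpa [hzx] using hy
  · simpa [hzx, hzy] using hp.1 z

theorem mulVec_le_mulVec_of_isMinOn_stdSimplex (hM : M.IsSymm) (hp : p ∈ stdSimplex ℝ V)
    (hmin : IsMinOn (fun p => p ⬝ᵥ (M *ᵥ p)) (stdSimplex ℝ V) p) {x : V} (hx : p x ≠ 0) (y : V) :
    (M *ᵥ p) x ≤ (M *ᵥ p) y := by
  classical
  by_contra! hlt
  have hxy : x ≠ y := by rintro rfl; exact hlt.false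
  set δ := (M *ᵥ p) x - (M *ᵥ p) y
  set C := M x x + M y y - 2 * M x y
  have : 0 < δ := sub_pos.2 hlt
  have hpx : 0 < p x := (hp.1 x).lt_of_ne' hx
  obtain ⟨s, hs, hsx, hsC⟩ : ∃ s, 0 < s ∧ s ≤ p x ∧ s * (|C| + 1) ≤ δ :=
    ⟨min (p x) (δ / (|C| + 1)), by positivity, min_le_left _ _,
      (le_div_iff₀ (by positivity)).1 (min_le_right _ _)⟩
  have hle := isMinOn_iff.1 hmin _ (add_smul_single_sub_single_mem_stdSimplex hp hxy
    (neg_le_neg hsx) (by linarith [hp.1 y]))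
  rw [dotProduct_mulVec_add_smul_single_sub_single hM] at hle
  have hdecrease : 0 ≤ s * (s * C - 2 * δ) := by linear_combination hle
  nlinarith [hdecrease, le_abs_self C]

theorem mulVec_eq_dotProduct_of_isMinOn_stdSimplex (hM : M.IsSymm) (hp : p ∈ stdSimplex ℝ V)
    (hmin : IsMinOn (fun p => p ⬝ᵥ (M *ᵥ p)) (stdSimplex ℝ V) p) {x : V} (hx : p x ≠ 0) :
    (M *ᵥ p) x = p ⬝ᵥ (M *ᵥ p) := by
  have hle {x : V} (hx : p x ≠ 0) (y : V) :=
    mulVec_le_mulVec_of_isMinOn_stdSimplex hM hp hmin hx y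
  have hconst (y : V) : p y * (M *ᵥ p) y = p y * (M *ᵥ p) x := by
    rcases eq_or_ne (p y) 0 with hy | hy
    · rw [hy, zero_mul, zero_mul]
    · rw [(hle hy x).antisymm (hle hx y)]
  simp only [dotProduct, hconst]
  rw [← sum_mul, hp.2, one_mul]

theorem exists_isMinOn_stdSimplex_minimal_support [Nonempty V] (M : Matrix V V ℝ) :
    ∃ p ∈ stdSimplex ℝ V, IsMinOn (fun p => p ⬝ᵥ (M *ᵥ p)) (stdSimplex ℝ V) p ∧
      ∀ p' ∈ stdSimplex ℝ V, p' ⬝ᵥ (M *ᵥ p') = p ⬝ᵥ (M *ᵥ p) →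
        ¬ Function.support p' ⊂ Function.support p := by
  classical
  have hcont : Continuous fun p : V → ℝ => p ⬝ᵥ (M *ᵥ p) :=
    continuous_id.dotProduct (continuous_const.matrix_mulVec continuous_id)
  obtain ⟨p₀, hp₀, hmin₀⟩ := (isCompact_stdSimplex ℝ V).exists_isMinOn
    ⟨_, single_mem_stdSimplex ℝ (Classical.arbitrary V)⟩ hcont.continuousOn
  obtain ⟨p, ⟨hp, hpΦ⟩, hsupp⟩ :=
    (measure fun p : V → ℝ => (Function.support p).ncard).wf.has_min
      {p | p ∈ stdSimplex ℝ V ∧ p ⬝ᵥ (M *ᵥ p) = p₀ ⬝ᵥ (M *ᵥ p₀)} ⟨p₀, hp₀, rfl⟩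
  exact ⟨p, hp, isMinOn_iff.2 fun p' hp' => hpΦ.trans_le (isMinOn_iff.1 hmin₀ p' hp'),
    fun p' hp' hΦ hss => hsupp p' ⟨hp', hΦ.trans hpΦ⟩ (Set.ncard_lt_ncard hss)⟩

theorem exists_isMinOn_stdSimplex_two_mul_lt [Nonempty V] (hM : M.IsSymm) :
    ∃ p ∈ stdSimplex ℝ V, IsMinOn (fun p => p ⬝ᵥ (M *ᵥ p)) (stdSimplex ℝ V) p ∧
      ∀ x y, x ≠ y → p x ≠ 0 → p y ≠ 0 → 2 * M x y < M x x + M y y := by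
  classical
  obtain ⟨p, hp, hmin, hsupp⟩ := exists_isMinOn_stdSimplex_minimal_support M
  refine ⟨p, hp, hmin, fun x y hxy hx hy => ?_⟩
  by_contra! hle
  -- The form is concave along `e_x - e_y`, so all the weight of `y` can be moved to `x`.
  have hx0 : 0 ≤ p x := hp.1 x
  have hy0 : 0 ≤ p y := hp.1 y
  set p' := p + p y • (Pi.single x 1 - Pi.single y 1) with hp'
  have hp'mem : p' ∈ stdSimplex ℝ V :=
    add_smul_single_sub_single_mem_stdSimplex hp hxy (by linarith) le_rfl
  have hΦ : p' ⬝ᵥ (M *ᵥ p') = p ⬝ᵥ (M *ᵥ p) := by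
    refine le_antisymm ?_ (isMinOn_iff.1 hmin p' hp'mem)
    rw [hp', dotProduct_mulVec_add_smul_single_sub_single hM,
      mulVec_eq_dotProduct_of_isMinOn_stdSimplex hM hp hmin hx,
      mulVec_eq_dotProduct_of_isMinOn_stdSimplex hM hp hmin hy]
    nlinarith [sq_nonneg (p y)]
  have hp'y : p' y = 0 := by simp [hp', hxy.symm]
  refine hsupp p' hp'mem hΦ (ssubset_of_subset_of_ne (fun z hz => ?_) fun heq => ?_)
  · rcases eq_or_ne z x with rfl | hzx
    · exact hx
    rcases eq_or_ne z y with rfl | hzy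
    · exact hy
    · simpa [hp', hzx, hzy] using hz
  · exact (heq ▸ hy : y ∈ Function.support p') hp'y

end QuadraticForm

namespace ColouredGraph

variable {V : Type*} {G : ColouredGraph V}

/-- The weight by which the edge `xy` falls short of being red. -/
def gap (G : ColouredGraph V) (x y : V) : ℕ := 2 - G.w x y

theorem gap_add_w (G : ColouredGraph V) (x y : V) : G.gap x y + G.w x y = 2 :=
  Nat.sub_add_cancel (G.le_two x y)

theorem gap_comm (G : ColouredGraph V) (x y : V) : G.gap x y = G.gap y x := by
  rw [gap, gap, G.symm]

theorem gap_le_two (G : ColouredGraph V) (x y : V) : G.gap x y ≤ 2 :=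
  Nat.sub_le _ _

theorem gap_self (G : ColouredGraph V) (x : V) : G.gap x x = 2 := by
  rw [gap, G.loopless]

theorem ne_of_w_ne_zero {x y : V} (h : G.w x y ≠ 0) : x ≠ y := by
  rintro rfl
  exact h (G.loopless x)

/-- All edges inside `s` have weight at least `k`: there are no green edges for `k = 1`, and all
edges are red for `k = 2`. -/
def IsClique (G : ColouredGraph V) (k : ℕ) (s : Set V) : Prop :=
  s.Pairwise fun x y => k ≤ G.w x y

theorem IsClique.insert {k : ℕ} {s : Set V} (hs : G.IsClique k s) {v : V}
    (hv : ∀ x ∈ s, k ≤ G.w v x) : G.IsClique k (insert v s) :=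
  haveI : Std.Symm fun x y => k ≤ G.w x y := ⟨fun x y h => by rwa [G.symm]⟩
  Set.pairwise_insert_of_symm.2 ⟨hs, fun x hx _ => hv x hx⟩

/-- Every clique `Q` without green edges and every nonempty red clique `R ⊆ Q` satisfy
`#Q + #R < t`. -/
def CliqueBound (G : ColouredGraph V) (t : ℕ) : Prop :=
  ∀ Q R : Finset V, R ⊆ Q → R.Nonempty → G.IsClique 1 Q → G.IsClique 2 R → #Q + #R < t

theorem free_iff_forall_injective {U : Type*} {F : ColouredGraph U} :
    Free F G ↔ ∀ f : U → V, f.Injective → ¬ ∀ x y, F.w x y ≤ G.w (f x) (f y) := by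
  constructor
  · intro h f hf hle
    let e : U ≃ Set.range f := .ofInjective f hf
    refine h ⟨Set.range f, ⟨fun x y => F.w (e.symm x) (e.symm y), fun _ _ => F.symm _ _,
      fun _ => F.loopless _, fun _ _ => F.le_two _ _⟩, fun x y => ?_, e, by simp⟩
    simpa [e, Equiv.apply_ofInjective_symm] using hle (e.symm x) (e.symm y)
  · rintro h ⟨S, H, hH, e, he⟩
    exact h _ (Subtype.val_injective.comp e.injective) fun x y =>
      (he x y).trans_le (hH (e x) (e y))

theorem exists_injective_cliqueGraph {Q R : Finset V} (hRQ : R ⊆ Q) (hR : R.Nonempty)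
    (hQ1 : G.IsClique 1 Q) (hR2 : G.IsClique 2 R) {a b : ℕ} (hba : b ≤ a) (ha : a ≤ #Q)
    (hb : b ≤ #R) :
    ∃ f : Fin a → V, f.Injective ∧ ∀ i j, (cliqueGraph a b).w i j ≤ G.w (f i) (f j) := by
  classical
  obtain ⟨R', hR'R, hR'⟩ := exists_subset_card_eq hb
  obtain ⟨Q', hRQ', hQ'Q, hQ'⟩ := exists_subsuperset_card_eq (hR'R.trans hRQ) (by omega) ha
  let e : Fin b ≃ R' := (R'.equivFinOfCardEq hR').symm
  let f₀ : Fin a → V := fun i => if h : i.val < b then e ⟨i, h⟩ else hR.choose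
  have mem_R' (i : Fin a) (hi : i.val < b) : f₀ i ∈ R' := by simp [f₀, hi]
  obtain ⟨g, hg⟩ : ∃ g : Fin a ≃ Q',
      ∀ i ∈ ({i | i.val < b} : Finset (Fin a)), (g i : V) = f₀ i := by
    refine exists_equiv_extend_of_card_eq (by simp [hQ']) ?_ fun i hi j hj hij => ?_
    · exact image_subset_iff.2 fun i hi => hRQ' (mem_R' i (by simpa using hi))
    · simp only [coe_filter, mem_univ, true_and, Set.mem_ofPred_eq] at hi hj
      simpa [f₀, hi, hj, Subtype.val_inj, Fin.ext_iff] using hij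
  have hinj : Function.Injective fun i => (g i : V) := Subtype.val_injective.comp g.injective
  refine ⟨_, hinj, fun i j => ?_⟩
  simp only [cliqueGraph]
  split_ifs with hij hlt
  · exact Nat.zero_le _
  · rw [hg i (by simpa using hlt.1), hg j (by simpa using hlt.2)]
    refine hR2 (hR'R (mem_R' i hlt.1)) (hR'R (mem_R' j hlt.2)) ?_
    rw [← hg i (by simpa using hlt.1), ← hg j (by simpa using hlt.2)]
    exact hinj.ne hij
  · exact hQ1 (hQ'Q (g i).2) (hQ'Q (g j).2) (hinj.ne hij)

theorem familyFree_family_iff_cliqueBound {r : ℕ} (hr : 1 ≤ r) :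
    G.FamilyFree (family (2 * r)) ↔ G.CliqueBound (2 * r) := by
  classical
  constructor
  · intro hG Q R hRQ hR hQ1 hR2
    by_contra! hle
    have := card_le_card hRQ
    have := hR.card_pos
    obtain ⟨a, b, hb, hba, hab, haQ, hbR⟩ :
        ∃ a b, 1 ≤ b ∧ b ≤ a ∧ a + b = 2 * r ∧ a ≤ #Q ∧ b ≤ #R :=
      ⟨2 * r - min r #R, min r #R, by omega, by omega, by omega, by omega, by omega⟩
    obtain ⟨f, hf, hfw⟩ := exists_injective_cliqueGraph hRQ hR hQ1 hR2 hba haQ hbR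
    exact free_iff_forall_injective.1 (hG _ ⟨a, b, hb, hba, hab, rfl⟩) f hf hfw
  · rintro hG _ ⟨a, b, hb, hba, hab, rfl⟩
    refine free_iff_forall_injective.2 fun (f : Fin a → V) hf hle => ?_
    have red : G.IsClique 2 (f '' {i | i.val < b}) :=
      Set.Pairwise.image fun i hi j hj hij => by
        simpa [cliqueGraph, hij, show i.val < b ∧ j.val < b from ⟨hi, hj⟩] using hle i j
    have nongreen : G.IsClique 1 (f '' Set.univ) :=
      Set.Pairwise.image fun i _ j _ hij => le_trans (by grind [cliqueGraph]) (hle i j)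
    have := hG (univ.image f) (image f {i | i.val < b}) (image_subset_image (subset_univ _))
      ⟨f ⟨0, hb.trans hba⟩, mem_image_of_mem f (by simpa using Nat.pos_of_ne_zero (by omega))⟩
      (by simpa using nongreen)
      (by simpa using red)
    have card_red : #(image f {i | i.val < b}) = min a b := by
      rw [card_image_of_injective _ hf, Fin.card_filter_val_lt]
    have card_nongreen : #(univ.image f) = a := by
      rw [card_image_of_injective _ hf, card_univ, Fintype.card_fin]
    omega

/-! ### Copies of `RK_r⁻` -/

/-- The weight of the edge between distinct vertices `k`, `l` of the copy of `RK_r⁻` on `Bool ⊕ ι`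
whose blue edge joins the two elements of `Bool`. -/
def pairWeight {ι : Type*} (k l : Bool ⊕ ι) : ℕ := if k.isLeft ∧ l.isLeft then 1 else 2

/-- A copy of `RK_r⁻` in `G`, where `r = #ι + 2`: the left vertices are joined by a blue edge, all
other edges are red. -/
structure Frame (G : ColouredGraph V) (ι : Type*) where
  toFun : Bool ⊕ ι → V
  w_eq : ∀ k l, k ≠ l → G.w (toFun k) (toFun l) = pairWeight k l

namespace Frame

variable {ι : Type*}

instance : CoeFun (Frame G ι) fun _ => Bool ⊕ ι → V := ⟨toFun⟩

theorem pairWeight_comm (k l : Bool ⊕ ι) : pairWeight k l = pairWeight l k := by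
  simp only [pairWeight, and_comm]

theorem pairWeight_pos (k l : Bool ⊕ ι) : 1 ≤ pairWeight k l := by
  rw [pairWeight]
  split_ifs <;> omega

theorem injective (K : Frame G ι) : Function.Injective K := fun k l h => by
  by_contra hkl
  have hw := K.w_eq k l hkl
  rw [h, G.loopless] at hw
  have := pairWeight_pos k l
  omega

/-- The frame on `f`, where `f` is red away from `inl b`. -/
def ofRed (f : Bool ⊕ ι → V) (b : Bool)
    (hred : ∀ k l, k ≠ l → k ≠ .inl b → l ≠ .inl b → G.w (f k) (f l) = 2)
    (hb : ∀ k, k ≠ .inl b → G.w (f (.inl b)) (f k) = pairWeight (.inl b) k) : Frame G ι where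
  toFun := f
  w_eq k l hkl := by
    by_cases hk : k = .inl b
    · subst hk
      exact hb l hkl.symm
    by_cases hl : l = .inl b
    · subst hl
      rw [G.symm, hb k hkl, pairWeight_comm]
    rw [hred k l hkl hk hl, pairWeight, if_neg]
    rintro ⟨hk', hl'⟩
    obtain ⟨x, rfl⟩ := Sum.isLeft_iff.1 hk'
    obtain ⟨y, rfl⟩ := Sum.isLeft_iff.1 hl'
    cases b <;> cases x <;> cases y <;> simp_all

theorem isClique_one_range (K : Frame G ι) : G.IsClique 1 (Set.range K) := by
  rintro _ ⟨k, rfl⟩ _ ⟨l, rfl⟩ hkl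
  exact (pairWeight_pos k l).trans_eq (K.w_eq k l fun h => hkl (h ▸ rfl)).symm

theorem isClique_two_image_compl (K : Frame G ι) (b : Bool) :
    G.IsClique 2 (K '' {.inl b}ᶜ) := by
  refine Set.Pairwise.image fun k hk l hl hkl => ?_
  rw [Function.onFun, K.w_eq k l hkl, pairWeight, if_neg]
  rintro ⟨hk', hl'⟩
  obtain ⟨x, rfl⟩ := Sum.isLeft_iff.1 hk'
  obtain ⟨y, rfl⟩ := Sum.isLeft_iff.1 hl'
  cases b <;> cases x <;> cases y <;> simp_all

/-- `v` is joined to the other vertices of `K` in the same way as the vertex `K k`. -/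
def IsTwin (K : Frame G ι) (k : Bool ⊕ ι) (v : V) : Prop :=
  ∀ l, l ≠ k → G.w v (K l) = pairWeight k l

theorem isTwin_self (K : Frame G ι) (k : Bool ⊕ ι) : K.IsTwin k (K k) :=
  fun l hl => K.w_eq k l hl.symm

section Replace

variable [DecidableEq ι]

/-- The frame `K` with `K k` replaced by its twin `v`. -/
def replace (K : Frame G ι) (k : Bool ⊕ ι) (v : V) (hv : K.IsTwin k v) : Frame G ι where
  toFun := Function.update K k v
  w_eq l l' hl := by
    rcases eq_or_ne l k with rfl | hlk
    · rw [Function.update_self, Function.update_of_ne hl.symm, hv l' hl.symm]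
    rcases eq_or_ne l' k with rfl | hlk'
    · rw [Function.update_self, Function.update_of_ne hl, G.symm, hv l hl, pairWeight_comm]
    · rw [Function.update_of_ne hlk, Function.update_of_ne hlk', K.w_eq l l' hl]

theorem coe_replace (K : Frame G ι) (k : Bool ⊕ ι) (v : V) (hv : K.IsTwin k v) :
    ⇑(K.replace k v hv) = Function.update K k v := rfl

theorem replace_self (K : Frame G ι) {k : Bool ⊕ ι} {v : V} (hv : K.IsTwin k v) :
    K.replace k v hv k = v := by
  rw [coe_replace, Function.update_self]

theorem replace_of_ne (K : Frame G ι) {k l : Bool ⊕ ι} {v : V} (hv : K.IsTwin k v) (h : l ≠ k) :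
    K.replace k v hv l = K l := by
  rw [coe_replace, Function.update_of_ne h]

end Replace

section CliqueBound

variable [Fintype ι] {K : Frame G ι} {k : Bool ⊕ ι} {u v : V}

theorem exists_green (K : Frame G ι) (hG : G.CliqueBound (2 * Fintype.card ι + 4)) (v : V) :
    ∃ k, G.w v (K k) = 0 := by
  classical
  by_contra! hv
  have hvK : v ∉ univ.image K := by
    simpa only [mem_image_univ_iff_mem_range, Set.mem_range, not_exists] using
      fun k => (ne_of_w_ne_zero (hv k)).symm
  have nongreen : G.IsClique 1 (insert v (univ.image K) : Finset V) := by
    rw [coe_insert, coe_image, coe_univ, Set.image_univ]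
    exact K.isClique_one_range.insert (Set.forall_mem_range.2 fun k => Nat.pos_of_ne_zero (hv k))
  have red : G.IsClique 2 (({.inl true}ᶜ : Finset (Bool ⊕ ι)).image K : Finset V) := by
    rw [coe_image, coe_compl, coe_singleton]
    exact K.isClique_two_image_compl true
  have hlt := hG _ _ ((image_subset_image (subset_univ _)).trans (subset_insert _ _))
    ⟨K (.inl false), mem_image_of_mem K (by simp)⟩ nongreen red
  rw [card_insert_of_notMem hvK, card_image_of_injective _ K.injective,
    card_image_of_injective _ K.injective, card_compl, card_singleton, card_univ,
    Fintype.card_sum, Fintype.card_bool] at hlt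
  omega

theorem exists_not_red (K : Frame G ι) (hG : G.CliqueBound (2 * Fintype.card ι + 4)) (b : Bool)
    (v : V) : ∃ k, k ≠ .inl b ∧ G.w v (K k) ≠ 2 := by
  classical
  by_contra! hv
  let R := ({.inl b}ᶜ : Finset (Bool ⊕ ι)).image K
  have hvR : v ∉ R := by
    simp only [R, mem_image, mem_compl, mem_singleton, not_exists, not_and]
    exact fun k hk => (ne_of_w_ne_zero (G := G) (by rw [hv k hk]; omega)).symm
  have red : G.IsClique 2 (insert v R : Finset V) := by
    rw [coe_insert, coe_image, coe_compl, coe_singleton]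
    exact (K.isClique_two_image_compl b).insert
      (Set.forall_mem_image.2 fun k hk => (hv k hk).ge)
  have hlt := hG _ _ Subset.rfl (insert_nonempty v R) (red.mono' fun _ _ h => by omega) red
  rw [card_insert_of_notMem hvR, card_image_of_injective _ K.injective, card_compl, card_singleton,
    Fintype.card_sum, Fintype.card_bool] at hlt
  omega

theorem IsTwin.w_apply_eq_zero (hv : K.IsTwin k v)
    (hG : G.CliqueBound (2 * Fintype.card ι + 4)) : G.w v (K k) = 0 := by
  obtain ⟨l, hl⟩ := K.exists_green hG v
  rcases eq_or_ne l k with rfl | hlk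
  · exact hl
  · have := pairWeight_pos k l
    have := hv l hlk
    omega

theorem IsTwin.w_eq_zero (hu : K.IsTwin k u) (hv : K.IsTwin k v)
    (hG : G.CliqueBound (2 * Fintype.card ι + 4)) : G.w u v = 0 := by
  classical
  have hu' : (K.replace k v hv).IsTwin k u := fun l hl => by
    rw [K.replace_of_ne hv hl, hu l hl]
  simpa only [replace_self] using hu'.w_apply_eq_zero hG

theorem IsTwin.index_unique {l : Bool ⊕ ι} (hk : K.IsTwin k v) (hl : K.IsTwin l v)
    (hG : G.CliqueBound (2 * Fintype.card ι + 4)) : k = l := by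
  by_contra hkl
  have := hk.w_apply_eq_zero hG
  have := hl k hkl
  have := pairWeight_pos l k
  omega

theorem IsTwin.w_ne_two {b : Bool} (hu : K.IsTwin (.inl b) u) (hv : K.IsTwin (.inl !b) v)
    (hG : G.CliqueBound (2 * Fintype.card ι + 4)) : G.w u v ≠ 2 := by
  classical
  obtain ⟨k, hkb, hk⟩ := (K.replace _ v hv).exists_not_red hG b u
  rcases k with b' | i
  · obtain rfl : b' = !b := by cases b <;> cases b' <;> simp_all
    rwa [replace_self] at hk
  · rw [K.replace_of_ne hv (by simp), hu _ (by simp)] at hk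
    simp [pairWeight] at hk

theorem IsTwin.gap_eq_two (hu : K.IsTwin k u) (hv : K.IsTwin k v)
    (hG : G.CliqueBound (2 * Fintype.card ι + 4)) : G.gap u v = 2 := by
  rw [gap, hu.w_eq_zero hv hG]

theorem IsTwin.one_le_gap {b : Bool} (hu : K.IsTwin (.inl b) u) (hv : K.IsTwin (.inl !b) v)
    (hG : G.CliqueBound (2 * Fintype.card ι + 4)) : 1 ≤ G.gap u v := by
  have hne := hu.w_ne_two hv hG
  have hgap := G.gap_add_w u v
  omega

end CliqueBound

section RightGap

variable (K : Frame G ι)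

/-- The total gap between `v` and the right vertices of `K` indexed by `s`. -/
def rightGap (s : Finset ι) (v : V) : ℕ := ∑ i ∈ s, G.gap v (K (.inr i))

theorem gap_le_rightGap {s : Finset ι} {i : ι} (hi : i ∈ s) (v : V) :
    G.gap v (K (.inr i)) ≤ K.rightGap s v :=
  single_le_sum (f := fun i => G.gap v (K (.inr i))) (fun _ _ => Nat.zero_le _) hi

variable [Fintype ι]

theorem isTwin_inl_iff (b : Bool) (v : V) :
    K.IsTwin (.inl b) v ↔ G.gap v (K (.inl !b)) = 1 ∧ K.rightGap univ v = 0 := by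
  have hgap (x) := G.gap_add_w v x
  have hleft : G.w v (K (.inl !b)) = 1 ↔ G.gap v (K (.inl !b)) = 1 := by grind
  have hright (i) : G.w v (K (.inr i)) = 2 ↔ G.gap v (K (.inr i)) = 0 := by grind
  cases b <;> simp_all [IsTwin, pairWeight, rightGap]

theorem green_left_or_two_le_rightGap (hG : G.CliqueBound (2 * Fintype.card ι + 4)) (b : Bool)
    (v : V) :
    G.gap v (K (.inl b)) = 2 ∨ G.gap v (K (.inl !b)) = 2 ∨ 2 ≤ K.rightGap univ v := by
  obtain ⟨k, hk⟩ := K.exists_green hG v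
  have hgap := G.gap_add_w v (K k)
  rcases k with b' | i
  · cases b <;> cases b' <;> simp_all
  · have := K.gap_le_rightGap (mem_univ i) v
    omega

theorem one_le_gap_add_rightGap (hG : G.CliqueBound (2 * Fintype.card ι + 4)) (b : Bool)
    (v : V) : 1 ≤ G.gap v (K (.inl b)) + K.rightGap univ v := by
  obtain ⟨k, hkb, hk⟩ := K.exists_not_red hG (!b) v
  have hgap := G.gap_add_w v (K k)
  rcases k with b' | i
  · obtain rfl : b' = b := by cases b <;> cases b' <;> simp_all
    omega
  · have := K.gap_le_rightGap (mem_univ i) v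
    omega

variable [DecidableEq ι]

theorem gap_add_rightGap_erase (i : ι) (v : V) :
    G.gap v (K (.inr i)) + K.rightGap (univ.erase i) v = K.rightGap univ v :=
  add_sum_erase univ (fun i => G.gap v (K (.inr i))) (mem_univ i)

theorem isTwin_inr_iff (i : ι) (v : V) :
    K.IsTwin (.inr i) v ↔
      (∀ b, G.gap v (K (.inl b)) = 0) ∧ K.rightGap (univ.erase i) v = 0 := by
  have hgap (k) : G.w v (K k) = 2 ↔ G.gap v (K k) = 0 := by
    have := G.gap_add_w v (K k)
    omega
  simp [IsTwin, pairWeight, rightGap, hgap]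

theorem green_left_or_green_right_or_two_le_rightGap
    (hG : G.CliqueBound (2 * Fintype.card ι + 4)) (b : Bool) (i : ι) (v : V) :
    G.gap v (K (.inl b)) = 2 ∨ G.gap v (K (.inl !b)) = 2 ∨ G.gap v (K (.inr i)) = 2 ∨
      2 ≤ K.rightGap (univ.erase i) v := by
  obtain ⟨k, hk⟩ := K.exists_green hG v
  have hgap := G.gap_add_w v (K k)
  rcases k with b' | j
  · cases b <;> cases b' <;> simp_all
  · rcases eq_or_ne j i with rfl | hj
    · omega
    · have := K.gap_le_rightGap (mem_erase.2 ⟨hj, mem_univ j⟩) v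
      omega

end RightGap

section Twins

variable [Fintype V] (K : Frame G ι)

open Classical in
/-- The class of all twins of the vertex `K k`. -/
noncomputable def twins (k : Bool ⊕ ι) : Finset V := {v | K.IsTwin k v}

variable {K} {k : Bool ⊕ ι} {v : V}

theorem mem_twins : v ∈ K.twins k ↔ K.IsTwin k v := by
  simp [twins]

theorem disjoint_twins [Fintype ι] (hG : G.CliqueBound (2 * Fintype.card ι + 4))
    {l : Bool ⊕ ι} (hkl : k ≠ l) : Disjoint (K.twins k) (K.twins l) :=
  disjoint_left.2 fun _ hk hl => hkl ((mem_twins.1 hk).index_unique (mem_twins.1 hl) hG)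

variable (K) in
open Classical in
/-- The set of all vertices that are not twins of any vertex of `K`. -/
noncomputable def stray : Finset V := {v | ∀ k, ¬ K.IsTwin k v}

theorem mem_stray : v ∈ K.stray ↔ ∀ k, ¬ K.IsTwin k v := by
  simp [stray]

end Twins

end Frame

/-! ### Twin classes in dense graphs -/

/-- A coloured graph satisfying the hypotheses of the theorem for `r = m + 2`, where every vertex is
given mass `c` so that the total mass is `7 * r - 5`. -/
structure IsDense [Fintype V] (G : ColouredGraph V) (m : ℕ) (c : ℝ) : Prop where
  pos : 0 < c
  total : c * Fintype.card V = 7 * m + 9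
  sum_gap_lt : ∀ z, c * ∑ v, (G.gap v z : ℝ) < 14
  cliqueBound : G.CliqueBound (2 * m + 4)

namespace IsDense

variable [Fintype V] {c : ℝ}

theorem sum_le_sum {m : ℕ} (hD : G.IsDense m c) {f g : V → ℕ} (h : ∀ v, f v ≤ g v) :
    c * ∑ v, (f v : ℝ) ≤ c * ∑ v, (g v : ℝ) :=
  mul_le_mul_of_nonneg_left (Finset.sum_le_sum fun v _ => Nat.cast_le.2 (h v)) hD.pos.le

theorem sum_mul_card_lt {m : ℕ} (hD : G.IsDense m c) {κ : Type*} {s : Finset κ}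
    {S : κ → Finset V} (hS : (s : Set κ).PairwiseDisjoint S) {g : κ → ℕ} (z : V)
    (hg : ∀ k ∈ s, ∀ u ∈ S k, g k ≤ G.gap z u) :
    ∑ k ∈ s, g k * (c * #(S k)) < 14 := by
  classical
  have hsum : ∑ k ∈ s, g k * #(S k) ≤ ∑ u, G.gap u z := by
    calc ∑ k ∈ s, g k * #(S k)
        ≤ ∑ k ∈ s, ∑ u ∈ S k, G.gap u z := Finset.sum_le_sum fun k hk => by
          simpa only [G.gap_comm z, smul_eq_mul, mul_comm] using card_nsmul_le_sum _ _ _ (hg k hk)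
      _ = ∑ u ∈ s.biUnion S, G.gap u z := (sum_biUnion hS).symm
      _ ≤ ∑ u, G.gap u z := sum_le_sum_of_subset (subset_univ _)
  calc ∑ k ∈ s, g k * (c * #(S k)) = c * ((∑ k ∈ s, g k * #(S k) : ℕ) : ℝ) := by
        rw [Nat.cast_sum, mul_sum]
        exact sum_congr rfl fun k _ => by push_cast; ring
    _ ≤ c * ((∑ u, G.gap u z : ℕ) : ℝ) :=
        mul_le_mul_of_nonneg_left (Nat.cast_le.2 hsum) hD.pos.le
    _ < 14 := by simpa only [Nat.cast_sum] using hD.sum_gap_lt z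

theorem sum_rightGap_le {ι : Type*} {m : ℕ} (hD : G.IsDense m c) (K : Frame G ι) (s : Finset ι) :
    c * ∑ v, (K.rightGap s v : ℝ) ≤ 14 * #s := by
  simp only [Frame.rightGap, Nat.cast_sum]
  rw [sum_comm, mul_sum, mul_comm (14 : ℝ), ← nsmul_eq_mul]
  exact sum_le_card_nsmul _ _ _ fun i _ => (hD.sum_gap_lt _).le

end IsDense

namespace Frame

variable {ι : Type*}

theorem exists_swap_inl_inr (K : Frame G ι) (b : Bool) (i : ι) {x : V}
    (hleft : G.gap x (K (.inl !b)) = 0) (hi : G.gap x (K (.inr i)) = 1)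
    (hright : ∀ j ≠ i, G.gap x (K (.inr j)) = 0) :
    ∃ L : Frame G ι, L (.inl b) = x ∧ L (.inl !b) = K (.inr i) ∧ L (.inr i) = K (.inl !b) ∧
      ∀ j ≠ i, L (.inr j) = K (.inr j) := by
  classical
  let σ : Equiv.Perm (Bool ⊕ ι) := Equiv.swap (.inl !b) (.inr i)
  let f : Bool ⊕ ι → V := Function.update (K ∘ σ) (.inl b) x
  have hσb : σ (.inl b) = .inl b := Equiv.swap_apply_of_ne_of_ne (by simp) (by simp)
  have hσ (k) (hk : k ≠ .inl b) : σ k ≠ .inl b := fun h => hk (σ.injective (h.trans hσb.symm))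
  have hσj (j) (hj : j ≠ i) : σ (.inr j) = .inr j :=
    Equiv.swap_apply_of_ne_of_ne (by simp) (by simpa using hj)
  have hf (k) (hk : k ≠ .inl b) : f k = K (σ k) := Function.update_of_ne hk _ _
  have f_left : f (.inl b) = x := Function.update_self _ _ _
  have f_not_left : f (.inl !b) = K (.inr i) := by rw [hf _ (by simp), Equiv.swap_apply_left]
  have f_right : f (.inr i) = K (.inl !b) := by rw [hf _ (by simp), Equiv.swap_apply_right]
  have f_right_of_ne (j) (hj : j ≠ i) : f (.inr j) = K (.inr j) := by
    rw [hf _ (by simp), hσj j hj]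
  refine ⟨ofRed f b (fun k l hkl hk hl => ?_) fun k hk => ?_, f_left, f_not_left, f_right,
    f_right_of_ne⟩
  · rw [hf k hk, hf l hl]
    exact le_antisymm (G.le_two _ _) (K.isClique_two_image_compl b ⟨_, hσ k hk, rfl⟩
      ⟨_, hσ l hl, rfl⟩ (K.injective.ne (σ.injective.ne hkl)))
  · have hgap (k) := G.gap_add_w x (K k)
    rw [f_left]
    rcases k with b' | j
    · obtain rfl : b' = !b := by cases b <;> cases b' <;> simp_all
      grind [pairWeight]
    · rcases eq_or_ne j i with rfl | hj <;> grind [pairWeight]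

end Frame

namespace IsDense

variable [Fintype V] {c : ℝ} {ι : Type*} [Fintype ι]

theorem sum_rightGap_univ_le (hD : G.IsDense (Fintype.card ι) c) (K : Frame G ι) :
    c * ∑ v, (K.rightGap univ v : ℝ) ≤ 14 * Fintype.card ι :=
  hD.sum_rightGap_le K univ

theorem sum_rightGap_erase_le [DecidableEq ι] (hD : G.IsDense (Fintype.card ι) c) (K : Frame G ι)
    (i : ι) : c * ∑ v, (K.rightGap (univ.erase i) v : ℝ) ≤ 14 * (Fintype.card ι - 1) := by
  refine (hD.sum_rightGap_le K _).trans_eq ?_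
  rw [cast_card_erase_of_mem (mem_univ i), card_univ]

theorem total_mul (hD : G.IsDense (Fintype.card ι) c) (k : ℝ) :
    c * ∑ _v : V, k = k * (7 * Fintype.card ι + 9) := by
  rw [sum_const, card_univ, nsmul_eq_mul, ← hD.total]
  ring

theorem rightGap_erase_ne_zero [DecidableEq ι] (hD : G.IsDense (Fintype.card ι) c)
    (K : Frame G ι) {b : Bool} {i : ι} {x : V} (hleft : G.gap x (K (.inl !b)) = 0)
    (hi : G.gap x (K (.inr i)) = 1) : K.rightGap (univ.erase i) x ≠ 0 := by
  intro hzero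
  have hright (j) (hj : j ≠ i) : G.gap x (K (.inr j)) = 0 :=
    Nat.eq_zero_of_le_zero (hzero ▸ K.gap_le_rightGap (mem_erase.2 ⟨hj, mem_univ j⟩) x)
  obtain ⟨L, hLx, hLb, hLi, hLj⟩ := K.exists_swap_inl_inr b i hleft hi hright
  have hLgap (v) : L.rightGap (univ.erase i) v = K.rightGap (univ.erase i) v :=
    sum_congr rfl fun j hj => by rw [hLj j (ne_of_mem_erase hj)]
  have key (v) : 14 ≤ 2 * G.gap v (K (.inl b)) + 2 * G.gap v x + 6 * G.gap v (K (.inl !b)) +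
      6 * G.gap v (K (.inr i)) + 7 * K.rightGap (univ.erase i) v := by
    have greenK := K.green_left_or_green_right_or_two_le_rightGap hD.cliqueBound b i v
    have greenL := L.green_left_or_green_right_or_two_le_rightGap hD.cliqueBound b i v
    have redK := K.one_le_gap_add_rightGap hD.cliqueBound b v
    have redL := L.one_le_gap_add_rightGap hD.cliqueBound b v
    have redL' := L.one_le_gap_add_rightGap hD.cliqueBound (!b) v
    rw [← Frame.gap_add_rightGap_erase _ i] at redK redL redL'
    rw [hLx, hLi, hLgap] at redL
    rw [hLb, hLi, hLgap] at redL'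
    rw [hLx, hLb, hLi, hLgap] at greenL
    omega
  have hsum := hD.sum_le_sum key
  push_cast [sum_add_distrib, ← mul_sum] at hsum
  linarith [hD.total_mul 14, hD.sum_gap_lt (K (.inl b)), hD.sum_gap_lt x,
    hD.sum_gap_lt (K (.inl !b)), hD.sum_gap_lt (K (.inr i)), hD.sum_rightGap_erase_le K i]

theorem isTwin_inl_or_two_le (hD : G.IsDense (Fintype.card ι) c) (K : Frame G ι) (b : Bool)
    (v : V) : K.IsTwin (.inl b) v ∨ 2 ≤ G.gap v (K (.inl !b)) + K.rightGap univ v := by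
  classical
  rw [K.isTwin_inl_iff]
  by_contra! hsmall
  have hred := K.one_le_gap_add_rightGap hD.cliqueBound (!b) v
  have hleft : G.gap v (K (.inl !b)) = 0 := by omega
  obtain ⟨i, -, hi⟩ := exists_ne_zero_of_sum_ne_zero (by omega : K.rightGap univ v ≠ 0)
  have := K.gap_add_rightGap_erase i v
  exact hD.rightGap_erase_ne_zero K hleft (i := i) (by omega) (by omega)

theorem six_lt_twins_inr (hD : G.IsDense (Fintype.card ι) c) (K : Frame G ι) (i : ι) :
    6 < c * #(K.twins (.inr i)) := by
  classical
  have key (v) : 6 ≤ 2 * (if v ∈ K.twins (.inr i) then 1 else 0) + 2 * G.gap v (K (.inl true)) +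
      2 * G.gap v (K (.inl false)) + 2 * G.gap v (K (.inr i)) +
      3 * K.rightGap (univ.erase i) v := by
    have green := K.green_left_or_green_right_or_two_le_rightGap hD.cliqueBound true i v
    have red := K.one_le_gap_add_rightGap hD.cliqueBound true v
    have red' := K.one_le_gap_add_rightGap hD.cliqueBound false v
    rw [← Frame.gap_add_rightGap_erase _ i] at red red'
    rw [Bool.not_true] at green
    split_ifs with htwin
    · omega
    · rw [Frame.mem_twins, K.isTwin_inr_iff, Bool.forall_bool] at htwin
      omega
  have hsum := hD.sum_le_sum key
  push_cast [sum_add_distrib, ← mul_sum, sum_boole, filter_univ_mem] at hsum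
  linarith [hD.total_mul 6, hD.sum_gap_lt (K (.inl true)), hD.sum_gap_lt (K (.inl false)),
    hD.sum_gap_lt (K (.inr i)), hD.sum_rightGap_erase_le K i]

theorem twelve_lt_twins_inl (hD : G.IsDense (Fintype.card ι) c) (K : Frame G ι) (b : Bool) :
    12 < 2 * (c * #(K.twins (.inl b))) + c * #(K.twins (.inl !b)) := by
  classical
  have key (v) : 6 ≤ 2 * (if v ∈ K.twins (.inl b) then 1 else 0) +
      (if v ∈ K.twins (.inl !b) then 1 else 0) + G.gap v (K (.inl b)) +
      2 * G.gap v (K (.inl !b)) + 3 * K.rightGap univ v := by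
    have := K.green_left_or_two_le_rightGap hD.cliqueBound b v
    have twin := hD.isTwin_inl_or_two_le K b v
    have twin' := hD.isTwin_inl_or_two_le K (!b) v
    simp only [Frame.mem_twins, K.isTwin_inl_iff, Bool.not_not] at twin twin' ⊢
    split_ifs <;> omega
  have hsum := hD.sum_le_sum key
  push_cast [sum_add_distrib, ← mul_sum, sum_boole, filter_univ_mem] at hsum
  linarith [hD.total_mul 6, hD.sum_gap_lt (K (.inl b)), hD.sum_gap_lt (K (.inl !b)),
    hD.sum_rightGap_univ_le K]

theorem eight_le_of_mem_stray (hD : G.IsDense (Fintype.card ι) c) {K : Frame G ι} {v : V}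
    (hv : v ∈ K.stray) :
    8 ≤ 2 * G.gap v (K (.inl true)) + 2 * G.gap v (K (.inl false)) + 3 * K.rightGap univ v := by
  classical
  rw [Frame.mem_stray] at hv
  have twin := (hD.isTwin_inl_or_two_le K true v).resolve_left (hv _)
  have twin' := (hD.isTwin_inl_or_two_le K false v).resolve_left (hv _)
  rw [Bool.not_true] at twin
  rw [Bool.not_false] at twin'
  by_contra! hsmall
  obtain ⟨i, -, hi⟩ := exists_ne_zero_of_sum_ne_zero (by omega : K.rightGap univ v ≠ 0)
  have green := K.green_left_or_green_right_or_two_le_rightGap hD.cliqueBound true i v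
  have right := hv (.inr i)
  have := K.gap_add_rightGap_erase i v
  rw [K.isTwin_inr_iff, Bool.forall_bool] at right
  rw [Bool.not_true] at green
  omega

theorem stray_lt_one (hD : G.IsDense (Fintype.card ι) c) (K : Frame G ι) :
    c * #K.stray < 1 := by
  classical
  have key (v) : 6 + 2 * (if v ∈ K.stray then 1 else 0) ≤ 2 * G.gap v (K (.inl true)) +
      2 * G.gap v (K (.inl false)) + 3 * K.rightGap univ v := by
    split_ifs with hstray
    · exact hD.eight_le_of_mem_stray hstray
    · have green := K.green_left_or_two_le_rightGap hD.cliqueBound true v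
      have twin := hD.isTwin_inl_or_two_le K true v
      have twin' := hD.isTwin_inl_or_two_le K false v
      simp only [K.isTwin_inl_iff, Bool.not_true, Bool.not_false] at green twin twin'
      omega
  have hsum := hD.sum_le_sum key
  push_cast [sum_add_distrib, ← mul_sum, mul_add, sum_boole, filter_univ_mem] at hsum
  linarith [hD.total_mul 6, hD.sum_gap_lt (K (.inl true)), hD.sum_gap_lt (K (.inl false)),
    hD.sum_rightGap_univ_le K]

theorem sum_mul_twins_lt (hD : G.IsDense (Fintype.card ι) c) (K : Frame G ι) (z : V)
    {s : Finset (Bool ⊕ ι)} {g : Bool ⊕ ι → ℕ}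
    (hg : ∀ k ∈ s, ∀ u, K.IsTwin k u → g k ≤ G.gap z u) :
    ∑ k ∈ s, g k * (c * #(K.twins k)) < 14 :=
  hD.sum_mul_card_lt (fun _ _ _ _ => Frame.disjoint_twins hD.cliqueBound) z fun k hk u hu =>
    hg k hk u (Frame.mem_twins.1 hu)

theorem twins_inl_lt_fourteen (hD : G.IsDense (Fintype.card ι) c) (K : Frame G ι) (b : Bool) :
    2 * (c * #(K.twins (.inl b))) + c * #(K.twins (.inl !b)) < 14 := by
  classical
  have hgap (k) (hk : k ∈ ({.inl b, .inl !b} : Finset (Bool ⊕ ι))) (u) (hu : K.IsTwin k u) :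
      (if k = .inl b then 2 else 1) ≤ G.gap (K (.inl b)) u := by
    split_ifs with hkb
    · exact ((K.isTwin_self _).gap_eq_two (hkb ▸ hu) hD.cliqueBound).ge
    · obtain rfl : k = .inl !b := by simpa [hkb] using hk
      exact (K.isTwin_self _).one_le_gap hu hD.cliqueBound
  simpa using hD.sum_mul_twins_lt K _ hgap

theorem ten_lt_twins_inl (hD : G.IsDense (Fintype.card ι) c) (K : Frame G ι) (b : Bool) :
    10 < 3 * (c * #(K.twins (.inl b))) := by
  have hlt := hD.twins_inl_lt_fourteen K (!b)
  rw [Bool.not_not] at hlt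
  linarith [hD.twelve_lt_twins_inl K b]

theorem eight_lt_twins_inl_add (hD : G.IsDense (Fintype.card ι) c) (K : Frame G ι) (b : Bool) :
    8 < c * #(K.twins (.inl b)) + c * #(K.twins (.inl !b)) := by
  have hnot := hD.twelve_lt_twins_inl K (!b)
  rw [Bool.not_not] at hnot
  linarith [hD.twelve_lt_twins_inl K b]

end IsDense

namespace Frame

variable {ι : Type*}

/-- Outside the index set `s` no vertex of `K` can be replaced by a twin whose edge to `z` has
larger weight. -/
def IsTight (K : Frame G ι) (z : V) (s : Set (Bool ⊕ ι)) : Prop :=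
  ∀ k ∉ s, ∀ u, K.IsTwin k u → G.gap z (K k) ≤ G.gap z u

theorem exists_isTight [Finite ι] (K₀ : Frame G ι) (z : V) (s : Set (Bool ⊕ ι)) :
    ∃ K : Frame G ι, Set.EqOn K K₀ s ∧ K.IsTight z s := by
  classical
  have := Fintype.ofFinite ι
  obtain ⟨K, hKs, hmin⟩ := (measure fun K : Frame G ι => ∑ k, G.gap z (K k)).wf.has_min
    {K | Set.EqOn K K₀ s} ⟨K₀, fun _ _ => rfl⟩
  refine ⟨K, hKs, fun k hk u hu => ?_⟩
  by_contra! hlt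
  have hsum : ∑ l, G.gap z (K.replace k u hu l) < ∑ l, G.gap z (K l) := by
    refine sum_lt_sum (fun l _ => ?_) ⟨k, mem_univ k, by rwa [replace_self]⟩
    rcases eq_or_ne l k with rfl | hlk
    · rw [replace_self]
      exact hlt.le
    · rw [replace_of_ne K hu hlk]
  refine hmin (K.replace k u hu) (fun l hl => ?_) hsum
  rw [replace_of_ne K hu (ne_of_mem_of_not_mem hl hk)]
  exact hKs hl

end Frame

theorem fourteen_lt_of_eight_le {x y : ℝ} {p q R : ℕ} (hx : 10 < 3 * x) (hy : 10 < 3 * y)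
    (hxy : 12 < 2 * x + y) (hyx : 12 < 2 * y + x) (hp : p ≤ 2) (hq : q ≤ 2)
    (h : 8 ≤ 2 * p + 2 * q + 3 * R) : 14 < p * x + q * y + 6 * R := by
  rcases lt_or_ge R 3 with hR | hR
  · interval_cases R <;> interval_cases p <;> interval_cases q <;>
      first | omega | (push_cast; linarith)
  · have hpx : 0 ≤ p * x := mul_nonneg p.cast_nonneg (by linarith)
    have hqy : 0 ≤ q * y := mul_nonneg q.cast_nonneg (by linarith)
    have : (3 : ℝ) ≤ R := mod_cast hR
    linarith

namespace IsDense

variable [Fintype V] {c : ℝ} {ι : Type*} [Fintype ι]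

theorem exists_isTwin_of_isTight (hD : G.IsDense (Fintype.card ι) c) {K : Frame G ι} {z : V}
    (hK : K.IsTight z ∅) : ∃ k, K.IsTwin k z := by
  by_contra! hstray
  have hsum : ∑ k, G.gap z (K k) * (c * #(K.twins k)) < 14 :=
    hD.sum_mul_twins_lt K z fun k _ u hu => hK k (Set.notMem_empty k) u hu
  have hright : (6 : ℝ) * K.rightGap univ z ≤
      ∑ i, G.gap z (K (.inr i)) * (c * #(K.twins (.inr i))) := by
    rw [Frame.rightGap, Nat.cast_sum, mul_sum]
    exact Finset.sum_le_sum fun i _ => by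
      rw [mul_comm]
      exact mul_le_mul_of_nonneg_left (hD.six_lt_twins_inr K i).le (Nat.cast_nonneg _)
  have hall := fourteen_lt_of_eight_le (hD.ten_lt_twins_inl K true) (hD.ten_lt_twins_inl K false)
    (hD.twelve_lt_twins_inl K true) (hD.twelve_lt_twins_inl K false) (gap_le_two _ _ _)
    (gap_le_two _ _ _) (hD.eight_le_of_mem_stray (Frame.mem_stray.2 hstray))
  rw [Fintype.sum_sum_type, Fintype.sum_bool] at hsum
  linarith

theorem exists_frame_apply_eq (hD : G.IsDense (Fintype.card ι) c) (K₀ : Frame G ι) (z : V) :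
    ∃ (K : Frame G ι) (k : Bool ⊕ ι), K k = z := by
  classical
  obtain ⟨K, -, hK⟩ := K₀.exists_isTight z ∅
  obtain ⟨k, hk⟩ := hD.exists_isTwin_of_isTight hK
  exact ⟨K.replace k z hk, k, K.replace_self hk⟩

end IsDense

/-! ### Heavy and light vertices -/

section Heavy

variable [Fintype V] {v : V} {c : ℝ}

open Classical in
/-- The set of vertices joined to `v` by a green edge, including `v` itself. -/
noncomputable def green (G : ColouredGraph V) (v : V) : Finset V := {u | G.w v u = 0}

theorem mem_green {u : V} : u ∈ G.green v ↔ G.w v u = 0 := by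
  simp [green]

/-- The green neighbourhood of `v` has mass more than `6`. These vertices form the classes
`W₃, …, W_r` of the partition. -/
def IsHeavy (G : ColouredGraph V) (c : ℝ) (v : V) : Prop := 6 < c * #(G.green v)

end Heavy

namespace IsDense

variable [Fintype V] {c : ℝ} {ι : Type*} [Fintype ι] {K : Frame G ι}

theorem isHeavy_of_isTwin_inr (hD : G.IsDense (Fintype.card ι) c) {i : ι} {v : V}
    (hv : K.IsTwin (.inr i) v) : G.IsHeavy c v := by
  refine (hD.six_lt_twins_inr K i).trans_le (mul_le_mul_of_nonneg_left ?_ hD.pos.le)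
  exact mod_cast card_le_card fun u hu =>
    mem_green.2 (hv.w_eq_zero (Frame.mem_twins.1 hu) hD.cliqueBound)

theorem not_isHeavy_of_isTwin_inl (hD : G.IsDense (Fintype.card ι) c) {b : Bool} {v : V}
    (hv : K.IsTwin (.inl b) v) : ¬ G.IsHeavy c v := by
  classical
  intro hheavy
  have key (u) : (if u ∈ G.green v then 1 else 0) + (if u ∈ K.twins (.inl b) then 1 else 0) +
      (if u ∈ K.twins (.inl !b) then 1 else 0) ≤ G.gap u v := by
    have hgreen (hu : u ∈ G.green v) : G.gap v u = 2 := by rw [gap, mem_green.1 hu]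
    have hown (hu : u ∈ K.twins (.inl b)) :=
      hv.gap_eq_two (Frame.mem_twins.1 hu) hD.cliqueBound
    have hother (hu : u ∈ K.twins (.inl !b)) :=
      hv.one_le_gap (Frame.mem_twins.1 hu) hD.cliqueBound
    have hdisj : u ∈ K.twins (.inl b) → u ∉ K.twins (.inl !b) := fun hu =>
      disjoint_left.1 (Frame.disjoint_twins hD.cliqueBound (by simp)) hu
    rw [G.gap_comm]
    split_ifs <;> grind
  have hsum := hD.sum_le_sum key
  push_cast [sum_add_distrib, mul_add, sum_boole, filter_univ_mem] at hsum
  rw [IsHeavy] at hheavy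
  linarith [hD.sum_gap_lt v, hD.eight_lt_twins_inl_add K b]

theorem exists_inl_eq_of_not_isHeavy (hD : G.IsDense (Fintype.card ι) c) (K₀ : Frame G ι) {z : V}
    (hz : ¬ G.IsHeavy c z) : ∃ (K : Frame G ι) (b : Bool), K (.inl b) = z := by
  obtain ⟨K, b | i, rfl⟩ := hD.exists_frame_apply_eq K₀ z
  · exact ⟨K, b, rfl⟩
  · exact absurd (hD.isHeavy_of_isTwin_inr (K.isTwin_self _)) hz

theorem exists_inr_eq_of_isHeavy (hD : G.IsDense (Fintype.card ι) c) (K₀ : Frame G ι) {z : V}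
    (hz : G.IsHeavy c z) : ∃ (K : Frame G ι) (i : ι), K (.inr i) = z := by
  obtain ⟨K, b | i, rfl⟩ := hD.exists_frame_apply_eq K₀ z
  · exact absurd hz (hD.not_isHeavy_of_isTwin_inl (K.isTwin_self _))
  · exact ⟨K, i, rfl⟩

theorem disjoint_twins_inl_twins_inr (hD : G.IsDense (Fintype.card ι) c) (K L : Frame G ι)
    (b : Bool) (i : ι) : Disjoint (K.twins (.inl b)) (L.twins (.inr i)) :=
  disjoint_left.2 fun _ hu hu' => hD.not_isHeavy_of_isTwin_inl (Frame.mem_twins.1 hu)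
    (hD.isHeavy_of_isTwin_inr (Frame.mem_twins.1 hu'))

theorem exists_red_of_not_isHeavy (hD : G.IsDense (Fintype.card ι) c) (K : Frame G ι) {y : V}
    (hy : ¬ G.IsHeavy c y) (i : ι) : ∃ u, K.IsTwin (.inr i) u ∧ G.gap y u = 0 := by
  classical
  by_contra! hgap
  obtain ⟨L, b, rfl⟩ := hD.exists_inl_eq_of_not_isHeavy K hy
  have key (u) : 2 * (if u ∈ L.twins (.inl b) then 1 else 0) +
      (if u ∈ L.twins (.inl !b) then 1 else 0) + (if u ∈ K.twins (.inr i) then 1 else 0) ≤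
        G.gap u (L (.inl b)) := by
    have hown (hu : u ∈ L.twins (.inl b)) :=
      (L.isTwin_self (.inl b)).gap_eq_two (Frame.mem_twins.1 hu) hD.cliqueBound
    have hother (hu : u ∈ L.twins (.inl !b)) :=
      (L.isTwin_self (.inl b)).one_le_gap (Frame.mem_twins.1 hu) hD.cliqueBound
    have hright (hu : u ∈ K.twins (.inr i)) := hgap u (Frame.mem_twins.1 hu)
    have hdisj : u ∈ L.twins (.inl b) → u ∉ L.twins (.inl !b) := fun hu =>
      disjoint_left.1 (Frame.disjoint_twins hD.cliqueBound (by simp)) hu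
    have hdisj' (b') : u ∈ L.twins (.inl b') → u ∉ K.twins (.inr i) := fun hu =>
      disjoint_left.1 (hD.disjoint_twins_inl_twins_inr L K b' i) hu
    rw [G.gap_comm]
    split_ifs <;> grind
  have hsum := hD.sum_le_sum key
  push_cast [sum_add_distrib, mul_add, ← mul_sum, sum_boole, filter_univ_mem] at hsum
  linarith [hD.sum_gap_lt (L (.inl b)), hD.twelve_lt_twins_inl L b, hD.six_lt_twins_inr K i]

theorem exists_red_frame_of_not_isHeavy (hD : G.IsDense (Fintype.card ι) c) (K₀ : Frame G ι)
    {y : V} (hy : ¬ G.IsHeavy c y) :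
    ∃ K : Frame G ι, (∀ b, K (.inl b) = K₀ (.inl b)) ∧ ∀ i, G.w y (K (.inr i)) = 2 := by
  obtain ⟨K, hleft, hK⟩ := K₀.exists_isTight y (Set.range .inl)
  refine ⟨K, fun b => hleft ⟨b, rfl⟩, fun i => ?_⟩
  obtain ⟨u, hu, hyu⟩ := hD.exists_red_of_not_isHeavy K hy i
  have htight := hK (.inr i) (by simp) u hu
  have hgap := G.gap_add_w y (K (.inr i))
  omega

theorem w_le_one_of_not_isHeavy (hD : G.IsDense (Fintype.card ι) c) (K₀ : Frame G ι) {x y : V}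
    (hx : ¬ G.IsHeavy c x) (hy : ¬ G.IsHeavy c y) : G.w y x ≤ 1 := by
  obtain ⟨K, b, rfl⟩ := hD.exists_inl_eq_of_not_isHeavy K₀ hx
  obtain ⟨L, hleft, hright⟩ := hD.exists_red_frame_of_not_isHeavy K hy
  obtain ⟨k, hk, hkred⟩ := L.exists_not_red hD.cliqueBound (!b) y
  rcases k with b' | i
  · obtain rfl : b' = b := by cases b <;> cases b' <;> simp_all
    rw [hleft] at hkred
    have := G.le_two y (K (.inl b'))
    omega
  · exact absurd (hright i) hkred

theorem exists_w_eq_zero_of_not_isHeavy (hD : G.IsDense (Fintype.card ι) c) (K₀ : Frame G ι)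
    {x y z : V} (hx : ¬ G.IsHeavy c x) (hy : ¬ G.IsHeavy c y) (hz : ¬ G.IsHeavy c z) :
    G.w y x = 0 ∨ G.w z x = 0 ∨ G.w z y = 0 := by
  classical
  by_contra! hne
  have hyx : G.w y x = 1 := by
    have := hD.w_le_one_of_not_isHeavy K₀ hx hy
    omega
  obtain ⟨K, b, rfl⟩ := hD.exists_inl_eq_of_not_isHeavy K₀ hx
  obtain ⟨L, hLleft, hLright⟩ := hD.exists_red_frame_of_not_isHeavy K hy
  have hytwin : L.IsTwin (.inl !b) y := by
    intro k hk
    rcases k with b' | i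
    · obtain rfl : b' = b := by cases b <;> cases b' <;> simp_all
      rw [hLleft, hyx]
      rfl
    · rw [hLright]
      rfl
  obtain ⟨M, hMleft, hMright⟩ :=
    hD.exists_red_frame_of_not_isHeavy (L.replace (.inl !b) y hytwin) hz
  obtain ⟨k, hk⟩ := M.exists_green hD.cliqueBound z
  rcases k with b' | i
  · rcases Bool.eq_or_eq_not b' b with rfl | rfl
    · rw [hMleft, Frame.replace_of_ne _ _ (by simp), hLleft] at hk
      exact hne.2.1 hk
    · rw [hMleft, Frame.replace_self] at hk
      exact hne.2.2 hk
  · simp [hMright] at hk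

variable {m : ℕ}

theorem green_lt_seven (hD : G.IsDense m c) {z : V} {S : Finset V} (hS : ∀ u ∈ S, G.w z u = 0) :
    c * #S < 7 := by
  have hlt := hD.sum_mul_card_lt (S := fun _ : Unit => S) (s := {()}) (g := fun _ => 2)
    (Set.subsingleton_of_subsingleton.pairwise _) z fun _ _ u hu => by rw [gap, hS u hu]
  rw [sum_singleton] at hlt
  push_cast at hlt
  linarith

theorem sub_one_lt_inter [DecidableEq V] (hD : G.IsDense m c) {z : V} {S T : Finset V}
    (hS : ∀ u ∈ S, G.w z u = 0) (hT : ∀ u ∈ T, G.w z u = 0) (hlarge : 6 < c * #S) :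
    c * #T - 1 < c * #(T ∩ S) := by
  have hunion := hD.green_lt_seven (S := T ∪ S) fun u hu => (mem_union.1 hu).elim (hT u) (hS u)
  have hcard : (#(T ∪ S) : ℝ) + #(T ∩ S) = #T + #S := mod_cast card_union_add_card_inter T S
  linear_combination hunion + hlarge - c * hcard

theorem exists_isTwin_inr_of_isTwin_inr (hD : G.IsDense (Fintype.card ι) c) (K L : Frame G ι)
    (j : ι) : ∃ u i, L.IsTwin (.inr j) u ∧ K.IsTwin (.inr i) u := by
  by_contra! hnone
  have hsub : L.twins (.inr j) ⊆ K.stray := fun u hu => by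
    rw [Frame.mem_twins] at hu
    rw [Frame.mem_stray]
    rintro (b | i) hk
    · exact hD.not_isHeavy_of_isTwin_inl hk (hD.isHeavy_of_isTwin_inr hu)
    · exact hnone u i hu hk
  have hcard : (#(L.twins (.inr j)) : ℝ) ≤ #K.stray := mod_cast card_le_card hsub
  linarith [mul_le_mul_of_nonneg_left hcard hD.pos.le, hD.stray_lt_one K, hD.six_lt_twins_inr L j]

open Classical in
theorem exists_label (hD : G.IsDense (Fintype.card ι) c) (K : Frame G ι) {v : V}
    (hv : G.IsHeavy c v) : ∃ i, 5 < c * #(G.green v ∩ K.twins (.inr i)) := by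
  obtain ⟨L, j, rfl⟩ := hD.exists_inr_eq_of_isHeavy K hv
  obtain ⟨u, i, huL, huK⟩ := hD.exists_isTwin_inr_of_isTwin_inr K L j
  refine ⟨i, ?_⟩
  have hinter := hD.sub_one_lt_inter (z := u) (S := K.twins (.inr i)) (T := L.twins (.inr j))
    (fun x hx => huK.w_eq_zero (Frame.mem_twins.1 hx) hD.cliqueBound)
    (fun x hx => huL.w_eq_zero (Frame.mem_twins.1 hx) hD.cliqueBound) (hD.six_lt_twins_inr K i)
  have hsub : L.twins (.inr j) ∩ K.twins (.inr i) ⊆ G.green (L (.inr j)) ∩ K.twins (.inr i) :=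
    inter_subset_inter_right fun x hx =>
      mem_green.2 ((L.isTwin_self _).w_eq_zero (Frame.mem_twins.1 hx) hD.cliqueBound)
  have hcard : (#(L.twins (.inr j) ∩ K.twins (.inr i)) : ℝ) ≤
      #(G.green (L (.inr j)) ∩ K.twins (.inr i)) := mod_cast card_le_card hsub
  linarith [mul_le_mul_of_nonneg_left hcard hD.pos.le, hD.six_lt_twins_inr L j]

open Classical in
theorem exists_inl_w_ne_zero (hD : G.IsDense (Fintype.card ι) c) (K L : Frame G ι) {v : V} {i : ι}
    (hv : 5 < c * #(G.green v ∩ K.twins (.inr i))) (b : Bool) :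
    ∃ u, L.IsTwin (.inl b) u ∧ G.w v u ≠ 0 := by
  by_contra! hgreen
  have hdisj : Disjoint (L.twins (.inl b)) (G.green v ∩ K.twins (.inr i)) :=
    (hD.disjoint_twins_inl_twins_inr L K b i).mono_right inter_subset_right
  have hunion := hD.green_lt_seven (z := v)
    (S := L.twins (.inl b) ∪ (G.green v ∩ K.twins (.inr i))) fun u hu =>
      (mem_union.1 hu).elim (fun hu => hgreen u (Frame.mem_twins.1 hu)) fun hu =>
        mem_green.1 (mem_inter.1 hu).1
  rw [card_union_of_disjoint hdisj] at hunion
  push_cast at hunion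
  linarith [hD.ten_lt_twins_inl L b]

open Classical in
theorem index_eq_of_green (hD : G.IsDense (Fintype.card ι) c) (K L : Frame G ι) {u v : V}
    {i j k : ι} (hu : 5 < c * #(G.green u ∩ K.twins (.inr i)))
    (hv : 5 < c * #(G.green v ∩ K.twins (.inr i)))
    (huL : ∀ x, L.IsTwin (.inr j) x → G.w u x = 0)
    (hvL : ∀ x, L.IsTwin (.inr k) x → G.w v x = 0) :
    j = k := by
  by_contra hjk
  let U := G.green u ∩ K.twins (.inr i)
  let W := G.green v ∩ K.twins (.inr i)
  have hU := hD.sub_one_lt_inter (T := U) (fun x hx => huL x (Frame.mem_twins.1 hx))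
    (fun x hx => mem_green.1 (inter_subset_left hx)) (hD.six_lt_twins_inr L j)
  have hW := hD.sub_one_lt_inter (T := W) (fun x hx => hvL x (Frame.mem_twins.1 hx))
    (fun x hx => mem_green.1 (inter_subset_left hx)) (hD.six_lt_twins_inr L k)
  have hdisj : Disjoint (U ∩ L.twins (.inr j)) (W ∩ L.twins (.inr k)) :=
    (Frame.disjoint_twins hD.cliqueBound (by simpa using hjk)).mono inter_subset_right
      inter_subset_right
  have hK := hD.green_lt_seven (z := K (.inr i))
    (S := U ∩ L.twins (.inr j) ∪ W ∩ L.twins (.inr k)) fun x hx =>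
      (K.isTwin_self _).w_eq_zero (Frame.mem_twins.1 (by grind)) hD.cliqueBound
  rw [card_union_of_disjoint hdisj] at hK
  push_cast at hK
  linarith

open Classical in
theorem w_eq_zero_of_label (hD : G.IsDense (Fintype.card ι) c) (K : Frame G ι) {u v : V} {i : ι}
    (hu : G.IsHeavy c u) (hui : 5 < c * #(G.green u ∩ K.twins (.inr i)))
    (hvi : 5 < c * #(G.green v ∩ K.twins (.inr i))) : G.w v u = 0 := by
  obtain ⟨L₀, j, rfl⟩ := hD.exists_inr_eq_of_isHeavy K hu
  obtain ⟨L, hLj, hL⟩ := L₀.exists_isTight v {.inr j}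
  have hLj : L (.inr j) = L₀ (.inr j) := hLj rfl
  rw [← hLj] at hui ⊢
  obtain ⟨k, hk⟩ := L.exists_green hD.cliqueBound v
  by_cases hkj : k = .inr j
  · rwa [← hkj]
  have hgreen (x) (hx : L.IsTwin k x) : G.w v x = 0 := by
    have := hL k hkj x hx
    have := G.gap_add_w v x
    have := G.gap_add_w v (L k)
    omega
  rcases k with b | k
  · obtain ⟨x, hx, hne⟩ := hD.exists_inl_w_ne_zero K L hvi b
    exact absurd (hgreen x hx) hne
  · obtain rfl := hD.index_eq_of_green K L hui hvi
      (fun x hx => (L.isTwin_self _).w_eq_zero hx hD.cliqueBound) hgreen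
    exact hk

theorem exists_heavy_colouring (hD : G.IsDense (Fintype.card ι) c) (K : Frame G ι) :
    ∃ f : {v // G.IsHeavy c v} → ι, ∀ x y, f x = f y → G.w x y = 0 := by
  classical
  choose f hf using fun v : {v // G.IsHeavy c v} => hD.exists_label K v.2
  exact ⟨f, fun x y hxy => hD.w_eq_zero_of_label K y.2 (hf y) (hxy ▸ hf x)⟩

open Classical in
theorem nine_le_light (hD : G.IsDense (Fintype.card ι) c) {f : {v // G.IsHeavy c v} → ι}
    (hf : ∀ x y, f x = f y → G.w x y = 0) : 9 ≤ c * Fintype.card {v // ¬ G.IsHeavy c v} := by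
  have hclass (i) : c * (#{x | f x = i} : ℝ) ≤ 7 := by
    rcases eq_empty_or_nonempty ({x | f x = i} : Finset _) with hempty | ⟨z, hz⟩
    · simp [hempty]
    · rw [← card_map (Function.Embedding.subtype _)]
      refine (hD.green_lt_seven (z := z) fun u hu => ?_).le
      obtain ⟨u, hu, rfl⟩ := mem_map.1 hu
      exact hf z u (by simp_all)
  have hheavy : c * Fintype.card {v // G.IsHeavy c v} ≤ 7 * Fintype.card ι := by
    rw [← card_univ, card_eq_sum_card_fiberwise (f := f) fun _ _ => mem_univ _, Nat.cast_sum,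
      mul_sum, mul_comm (7 : ℝ), ← nsmul_eq_mul, ← card_univ]
    exact sum_le_card_nsmul _ _ _ fun i _ => hclass i
  have hcard : (Fintype.card {v // G.IsHeavy c v} : ℝ) + Fintype.card {v // ¬ G.IsHeavy c v} =
      Fintype.card V := mod_cast by rw [← Fintype.card_sum, Fintype.card_congr (Equiv.sumCompl _)]
  linarith [hD.total, congrArg (c * ·) hcard]

end IsDense

/-- The simple graph of all blue and red edges. -/
def nonGreenGraph (G : ColouredGraph V) : SimpleGraph V where
  Adj x y := G.w x y ≠ 0
  symm := ⟨fun x y h => by rwa [G.symm]⟩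
  loopless := ⟨fun x h => h (G.loopless x)⟩

namespace IsDense

variable [Fintype V] {c : ℝ} {m : ℕ} {ι : Type*} [Fintype ι]

theorem two_mul_card_lt_degree (hD : G.IsDense m c) {s : Set V} [Fintype s]
    [DecidableRel (G.nonGreenGraph.induce s).Adj] (hs : ∀ x ∈ s, ∀ y ∈ s, G.w x y ≤ 1) (x : s) :
    2 * (c * Fintype.card s) < c * (G.nonGreenGraph.induce s).degree x + 14 := by
  classical
  have hdeg : 2 * Fintype.card s ≤ (G.nonGreenGraph.induce s).degree x + ∑ v, G.gap v x := by
    calc 2 * Fintype.card s = ∑ _y : s, 2 := by simp [mul_comm]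
      _ ≤ ∑ y : s, ((if (G.nonGreenGraph.induce s).Adj x y then 1 else 0) + G.gap y x) := by
        refine Finset.sum_le_sum fun y _ => ?_
        have := hs x x.2 y y.2
        have := G.gap_add_w x y
        rw [G.gap_comm y]
        split_ifs with hadj
        · omega
        · have : G.w x y = 0 := not_not.1 hadj
          omega
      _ = (G.nonGreenGraph.induce s).degree x + ∑ y : s, G.gap y x := by
        rw [sum_add_distrib, ← card_filter, ← SimpleGraph.card_neighborFinset_eq_degree,
          SimpleGraph.neighborFinset_eq_filter]
      _ ≤ _ := by
        gcongr
        exact (sum_map univ (.subtype (· ∈ s)) fun v => G.gap v x).ge.trans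
          (sum_le_sum_of_subset (subset_univ _))
  have hcast : (2 : ℝ) * Fintype.card s ≤
      (G.nonGreenGraph.induce s).degree x + ∑ v, (G.gap v x : ℝ) := mod_cast hdeg
  linarith [mul_le_mul_of_nonneg_left hcast hD.pos.le, hD.sum_gap_lt x]

theorem exists_light_colouring (hD : G.IsDense (Fintype.card ι) c) (K : Frame G ι)
    {f : {v // G.IsHeavy c v} → ι} (hf : ∀ x y, f x = f y → G.w x y = 0) :
    ∃ g : {v // ¬ G.IsHeavy c v} → Bool, ∀ x y, g x = g y → G.w x y = 0 := by
  classical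
  let L : Set V := {v | ¬ G.IsHeavy c v}
  let H := G.nonGreenGraph.induce L
  have hlight : 9 ≤ c * Fintype.card L := hD.nine_le_light hf
  have hfree : H.CliqueFree (2 + 1) := fun s hs => by
    obtain ⟨x, y, z, hxy, hxz, hyz, -⟩ := SimpleGraph.is3Clique_iff.1 hs
    rcases hD.exists_w_eq_zero_of_not_isHeavy K z.2 y.2 x.2 with h | h | h
    exacts [hyz h, hxz h, hxy h]
  have hdeg (x) : 4 * Fintype.card L < 9 * H.degree x := by
    have hlt : 2 * (c * Fintype.card L) < c * H.degree x + 14 := hD.two_mul_card_lt_degree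
      (s := L) (fun x hx y hy => hD.w_le_one_of_not_isHeavy K hy hx) x
    have hmul : c * (4 * Fintype.card L : ℕ) < c * (9 * H.degree x : ℕ) := by
      push_cast
      linarith
    exact Nat.cast_lt.1 (lt_of_mul_lt_mul_left hmul hD.pos.le)
  have : Nonempty L := by
    rw [← Fintype.card_pos_iff, Nat.pos_iff_ne_zero]
    intro h
    norm_num [h] at hlight
  obtain ⟨x, hx⟩ := H.exists_minimal_degree_vertex
  obtain ⟨col⟩ : H.Colorable 2 := SimpleGraph.colorable_of_cliqueFree_lt_minDegree hfree <| by
    have := hdeg x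
    rw [hx]
    omega
  refine ⟨fun v => finTwoEquiv (col v), fun x y hxy => ?_⟩
  by_contra hne
  exact col.valid hne (finTwoEquiv.injective hxy)

theorem exists_colouring (hD : G.IsDense (Fintype.card ι) c) (K : Frame G ι) :
    ∃ φ : V → Bool ⊕ ι, ∀ x y,
      (φ x = φ y → G.w x y = 0) ∧ ((φ x).isLeft → (φ y).isLeft → G.w x y ≠ 2) := by
  classical
  obtain ⟨f, hf⟩ := hD.exists_heavy_colouring K
  obtain ⟨g, hg⟩ := hD.exists_light_colouring K hf
  refine ⟨fun v => if h : G.IsHeavy c v then .inr (f ⟨v, h⟩) else .inl (g ⟨v, h⟩),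
    fun x y => ?_⟩
  by_cases hx : G.IsHeavy c x <;> by_cases hy : G.IsHeavy c y
  · simpa [hx, hy] using hf ⟨x, hx⟩ ⟨y, hy⟩
  · simp [hx, hy]
  · simp [hx, hy]
  · have := hD.w_le_one_of_not_isHeavy K hy hx
    simpa [hx, hy] using ⟨hg ⟨x, hx⟩ ⟨y, hy⟩, by omega⟩

end IsDense

/-! ### Existence of a copy of `RK_r⁻` -/

/-- `S` is a largest red clique contained in `K`. -/
structure IsMaxRed (G : ColouredGraph V) (K S : Finset V) : Prop where
  subset : S ⊆ K
  red : G.IsClique 2 S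
  card_le : ∀ R ⊆ K, G.IsClique 2 R → #R ≤ #S

theorem exists_isMaxRed (G : ColouredGraph V) (K : Finset V) : ∃ S, G.IsMaxRed K S := by
  classical
  obtain ⟨S, hS, hmax⟩ := exists_max_image
    (K.powerset.filter fun S : Finset V => G.IsClique 2 S) card
    ⟨∅, mem_filter.2 ⟨empty_mem_powerset K, by simp [IsClique]⟩⟩
  simp only [mem_filter, mem_powerset] at hS hmax
  exact ⟨S, hS.1, hS.2, fun R hR hred => hmax R ⟨hR, hred⟩⟩

namespace IsMaxRed

variable {K S : Finset V}

theorem nonempty (hS : G.IsMaxRed K S) (hK : K.Nonempty) : S.Nonempty := by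
  obtain ⟨x, hx⟩ := hK
  exact card_pos.1 (hS.card_le {x} (by simpa using hx) (by simp [IsClique]))

theorem exists_not_red [DecidableEq V] (hS : G.IsMaxRed K S) {t : V} (ht : t ∈ K \ S) :
    ∃ s ∈ S, 1 ≤ G.gap t s := by
  by_contra! hred
  obtain ⟨htK, htS⟩ := mem_sdiff.1 ht
  have hle := hS.card_le (insert t S) (insert_subset htK hS.subset) (by
    rw [coe_insert]
    exact hS.red.insert fun s hs => by have := hred s hs; have := G.gap_add_w t s; omega)
  rw [card_insert_of_notMem htS] at hle
  omega

theorem swap [DecidableEq V] (hS : G.IsMaxRed K S) {s t : V} (hs : s ∈ S) (ht : t ∈ K \ S)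
    (hred : ∀ s' ∈ S, s' ≠ s → G.w t s' = 2) : G.IsMaxRed K (insert t (S.erase s)) where
  subset := insert_subset (mem_sdiff.1 ht).1 ((erase_subset _ _).trans hS.subset)
  red := by
    rw [coe_insert]
    exact IsClique.insert (hS.red.mono (coe_subset.2 (erase_subset _ _))) fun x hx =>
      (hred x (mem_of_mem_erase hx) (ne_of_mem_erase hx)).ge
  card_le R hR hR2 := by
    rw [card_insert_of_notMem fun h => (mem_sdiff.1 ht).2 (mem_of_mem_erase h),
      card_erase_add_one hs]
    exact hS.card_le R hR hR2

end IsMaxRed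

/-- A positive weighting `q` of a clique `K` without green edges for which every vertex of `K` has
weighted gap `1` and the total weight exceeds `m / 2 + 9 / 14`. For dense `G` it is obtained by
rescaling a minimiser of `∑ x, ∑ y, gap x y * q x * q y` on the standard simplex. -/
structure IsBalanced (G : ColouredGraph V) (m : ℕ) (K : Finset V) (q : V → ℝ) : Prop where
  pos : ∀ x ∈ K, 0 < q x
  isClique : G.IsClique 1 K
  sum_gap : ∀ x ∈ K, ∑ y ∈ K, G.gap x y * q y = 1
  total : (m : ℝ) / 2 + 9 / 14 < ∑ x ∈ K, q x

namespace IsBalanced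

variable {m : ℕ} {K S : Finset V} {q : V → ℝ}

theorem gap_mul_nonneg (h : G.IsBalanced m K q) (x : V) : ∀ y ∈ K, 0 ≤ G.gap x y * q y :=
  fun y hy => mul_nonneg (Nat.cast_nonneg _) (h.pos y hy).le

theorem two_mul_le (h : G.IsBalanced m K q) {x : V} (hx : x ∈ K) : 2 * q x ≤ 1 := by
  rw [← h.sum_gap x hx]
  simpa [gap_self] using single_le_sum (h.gap_mul_nonneg x) hx

theorem two_mul_add_le (h : G.IsBalanced m K q) {x y : V} (hx : x ∈ K) (hy : y ∈ K)
    (hxy : x ≠ y) : 2 * q x + G.gap x y * q y ≤ 1 := by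
  rw [← h.sum_gap x hx]
  simpa [gap_self] using add_le_sum (h.gap_mul_nonneg x) hx hy hxy

theorem nonempty (h : G.IsBalanced m K q) : K.Nonempty := by
  by_contra hK
  have htotal := h.total
  rw [not_nonempty_iff_eq_empty.1 hK, sum_empty] at htotal
  linarith [Nat.cast_nonneg (α := ℝ) m]

theorem card_add_card_lt (h : G.IsBalanced m K q) (hG : G.CliqueBound (2 * m + 4))
    (hS : G.IsMaxRed K S) : #K + #S < 2 * m + 4 :=
  hG K S hS.subset (hS.nonempty h.nonempty) h.isClique hS.red

section Loss

variable [DecidableEq V]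

theorem card_eq (h : G.IsBalanced m K q) (hS : G.IsMaxRed K S) :
    (#S : ℝ) = 2 * ∑ s ∈ S, q s + ∑ t ∈ K \ S, (∑ s ∈ S, (G.gap t s : ℝ)) * q t := by
  have hone (s) (hs : s ∈ S) : 2 * q s + ∑ t ∈ K \ S, G.gap t s * q t = 1 := by
    have hinside : ∑ s' ∈ S, G.gap s s' * q s' = 2 * q s := by
      rw [sum_eq_single_of_mem s hs, gap_self, Nat.cast_ofNat]
      intro s' hs' hne
      rw [gap, Nat.sub_eq_zero_of_le (hS.red hs hs' hne.symm), Nat.cast_zero, zero_mul]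
    rw [← h.sum_gap s (hS.subset hs), ← sum_sdiff hS.subset, hinside, add_comm]
    simp only [G.gap_comm s]
  calc (#S : ℝ) = ∑ s ∈ S, (2 * q s + ∑ t ∈ K \ S, G.gap t s * q t) := by
        rw [sum_congr rfl hone, sum_const, nsmul_one]
    _ = _ := by rw [sum_add_distrib, ← mul_sum, sum_comm]; simp only [sum_mul]

/-- Summed over `K \ S`, this is the excess of `(#K + #S) / 4` over the total weight of `q`, because
the weighted gap of every vertex of `S` is `1`. -/
noncomputable def loss (G : ColouredGraph V) (S : Finset V) (q : V → ℝ) (t : V) : ℝ :=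
  1 / 4 - q t + (∑ s ∈ S, (G.gap t s : ℝ)) * q t / 2

theorem sum_loss_lt (h : G.IsBalanced m K q) (hG : G.CliqueBound (2 * m + 4))
    (hS : G.IsMaxRed K S) : ∑ t ∈ K \ S, loss G S q t < 3 / 28 := by
  have hcard : (2 : ℝ) * #S + #(K \ S) ≤ 2 * m + 3 := by
    have := h.card_add_card_lt hG hS
    have := card_sdiff_add_card_eq_card hS.subset
    exact_mod_cast (by omega)
  have htotal := h.total
  rw [← sum_sdiff hS.subset] at htotal
  simp only [loss]
  rw [sum_add_distrib, sum_sub_distrib, sum_const, nsmul_eq_mul, ← sum_div]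
  linarith [h.card_eq hS]

theorem loss_ge (h : G.IsBalanced m K q) (hS : G.IsMaxRed K S) {t : V} (ht : t ∈ K \ S) :
    1 / 4 - q t / 2 ≤ loss G S q t := by
  obtain ⟨s, hs, hts⟩ := hS.exists_not_red ht
  have hsum : (1 : ℝ) ≤ ∑ s ∈ S, (G.gap t s : ℝ) :=
    (Nat.one_le_cast.2 hts).trans
      (single_le_sum (f := fun s => (G.gap t s : ℝ)) (fun _ _ => Nat.cast_nonneg _) hs)
  have := mul_le_mul_of_nonneg_right hsum (h.pos t (mem_sdiff.1 ht).1).le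
  rw [loss]
  linarith

theorem loss_nonneg (h : G.IsBalanced m K q) (hS : G.IsMaxRed K S) :
    ∀ t ∈ K \ S, 0 ≤ loss G S q t := fun t ht => by
  linarith [h.loss_ge hS ht, h.two_mul_le (mem_sdiff.1 ht).1]

theorem loss_lt (h : G.IsBalanced m K q) (hG : G.CliqueBound (2 * m + 4))
    (hS : G.IsMaxRed K S) {t : V} (ht : t ∈ K \ S) : loss G S q t < 3 / 28 :=
  (single_le_sum (h.loss_nonneg hS) ht).trans_lt (h.sum_loss_lt hG hS)

theorem two_sevenths_lt (h : G.IsBalanced m K q) (hG : G.CliqueBound (2 * m + 4))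
    (hS : G.IsMaxRed K S) {t : V} (ht : t ∈ K \ S) : 2 / 7 < q t := by
  linarith [h.loss_lt hG hS ht, h.loss_ge hS ht]

theorem exists_unique_blue (h : G.IsBalanced m K q) (hG : G.CliqueBound (2 * m + 4))
    (hS : G.IsMaxRed K S) {t : V} (ht : t ∈ K \ S) :
    ∃ s ∈ S, G.w t s = 1 ∧ ∀ s' ∈ S, s' ≠ s → G.w t s' = 2 := by
  obtain ⟨s, hs, hts⟩ := hS.exists_not_red ht
  obtain ⟨htK, htS⟩ := mem_sdiff.1 ht
  have hnongreen : 1 ≤ G.w t s :=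
    h.isClique htK (hS.subset hs) (ne_of_mem_of_not_mem hs htS).symm
  refine ⟨s, hs, by have := G.gap_add_w t s; omega, fun s' hs' hne => ?_⟩
  by_contra hts'
  have hts' : 1 ≤ G.gap t s' := by have := G.gap_add_w t s'; omega
  have hsum : 2 ≤ ∑ s ∈ S, (G.gap t s : ℝ) := by
    have := add_le_sum (f := G.gap t) (fun _ _ => Nat.zero_le _) hs hs' hne.symm
    exact_mod_cast (by omega : 2 ≤ ∑ s ∈ S, G.gap t s)
  have := mul_le_mul_of_nonneg_right hsum (h.pos t htK).le
  have hloss := h.loss_lt hG hS ht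
  rw [loss] at hloss
  linarith

theorem le_five_fourteenths (h : G.IsBalanced m K q) (hG : G.CliqueBound (2 * m + 4))
    (hS : G.IsMaxRed K S) {t : V} (ht : t ∈ K \ S) : q t ≤ 5 / 14 := by
  obtain ⟨s, hs, hts, hred⟩ := h.exists_unique_blue hG hS ht
  obtain ⟨htK, htS⟩ := mem_sdiff.1 ht
  have hst : s ≠ t := ne_of_mem_of_not_mem hs htS
  have hqs : 2 / 7 < q s :=
    h.two_sevenths_lt hG (hS.swap hs ht hred) (by simp [hS.subset hs, hst])
  have hgap := h.two_mul_add_le htK (hS.subset hs) hst.symm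
  rw [gap, hts] at hgap
  norm_num at hgap
  linarith

theorem card_sdiff_le_one (h : G.IsBalanced m K q) (hG : G.CliqueBound (2 * m + 4))
    (hS : G.IsMaxRed K S) : #(K \ S) ≤ 1 := by
  by_contra! hlt
  obtain ⟨t, ht, t', ht', hne⟩ := one_lt_card.1 hlt
  linarith [add_le_sum (h.loss_nonneg hS) ht ht' hne, h.sum_loss_lt hG hS, h.loss_ge hS ht,
    h.loss_ge hS ht', h.le_five_fourteenths hG hS ht, h.le_five_fourteenths hG hS ht']

theorem exists_sdiff_eq_singleton (h : G.IsBalanced m K q) (hG : G.CliqueBound (2 * m + 4))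
    (hS : G.IsMaxRed K S) : ∃ t, K \ S = {t} ∧ #S = m + 1 := by
  have hlt := h.card_add_card_lt hG hS
  have hcard := card_sdiff_add_card_eq_card hS.subset
  have heq := h.card_eq hS
  have htotal := h.total
  rw [← sum_sdiff hS.subset] at htotal
  have hne : K \ S ≠ ∅ := fun hempty => by
    rw [hempty, sum_empty] at heq htotal
    rw [hempty, card_empty] at hcard
    have : (#S : ℝ) ≤ m + 1 := by exact_mod_cast (by omega)
    linarith
  obtain ⟨t, ht⟩ := card_eq_one.1 ((h.card_sdiff_le_one hG hS).antisymm
    (card_pos.2 (nonempty_iff_ne_empty.2 hne)))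
  have hmem : t ∈ K \ S := ht ▸ mem_singleton_self t
  have hloss := h.loss_ge hS hmem
  rw [loss] at hloss
  rw [ht, sum_singleton] at heq htotal
  rw [ht, card_singleton] at hcard
  have hm : (m : ℝ) < #S := by linarith [h.two_mul_le (mem_sdiff.1 hmem).1]
  have hm : m < #S := by exact_mod_cast hm
  exact ⟨t, ht, by omega⟩

end Loss

theorem nonempty_frame (h : G.IsBalanced m K q) (hG : G.CliqueBound (2 * m + 4)) :
    Nonempty (Frame G (Fin m)) := by
  classical
  obtain ⟨S, hS⟩ := G.exists_isMaxRed K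
  obtain ⟨t, ht, hcard⟩ := h.exists_sdiff_eq_singleton hG hS
  obtain ⟨s, hs, hts, hred⟩ := h.exists_unique_blue hG hS (ht ▸ mem_singleton_self t)
  let e : Fin m ≃ S.erase s :=
    ((S.erase s).equivFinOfCardEq (by rw [card_erase_of_mem hs, hcard]; rfl)).symm
  have heS (i) : (e i : V) ∈ S := mem_of_mem_erase (e i).2
  have hes (i) : (e i : V) ≠ s := ne_of_mem_erase (e i).2
  have red {x y : V} (hx : x ∈ S) (hy : y ∈ S) (hxy : x ≠ y) : G.w x y = 2 :=
    (G.le_two x y).antisymm (hS.red hx hy hxy)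
  refine ⟨.ofRed (Sum.elim (fun b => cond b s t) fun i => e i) false ?_ ?_⟩
  · rintro ((_ | _) | i) ((_ | _) | j) hkl hk hl <;> simp only [ne_eq, not_true] at hkl hk hl
    · exact red hs (heS j) (hes j).symm
    · exact red (heS i) hs (hes i)
    · exact red (heS i) (heS j) fun hij =>
        hkl (congrArg _ (e.injective (Subtype.val_injective hij)))
  · rintro ((_ | _) | i) hk
    · exact absurd rfl hk
    · exact hts
    · exact hred _ (heS i) (hes i)

end IsBalanced

section Lagrangian

open Matrix

/-- The symmetric matrix of the gaps between pairs of vertices, with `2` on the diagonal. -/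
def gapMatrix (G : ColouredGraph V) : Matrix V V ℝ := of fun x y => (G.gap x y : ℝ)

theorem isSymm_gapMatrix (G : ColouredGraph V) : G.gapMatrix.IsSymm := by
  ext x y
  rw [transpose_apply, gapMatrix, of_apply, of_apply, G.gap_comm]

variable [Fintype V]

theorem gapMatrix_mulVec_apply (p : V → ℝ) (x : V) :
    (G.gapMatrix *ᵥ p) x = ∑ y with p y ≠ 0, G.gap x y * p y := by
  refine (sum_subset (subset_univ _) fun y _ hy => ?_).symm
  rw [show p y = 0 by simpa using hy, mul_zero]

theorem dotProduct_gapMatrix_pos {p : V → ℝ} (hp : p ∈ stdSimplex ℝ V) :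
    0 < p ⬝ᵥ (G.gapMatrix *ᵥ p) := by
  have hnonneg (x y : V) : 0 ≤ G.gap x y * p y := mul_nonneg (Nat.cast_nonneg _) (hp.1 y)
  have hdiag (x : V) : 2 * p x ≤ (G.gapMatrix *ᵥ p) x := by
    simpa [gap_self, mulVec, dotProduct, gapMatrix] using
      single_le_sum (f := fun y => G.gap x y * p y) (fun y _ => hnonneg x y) (mem_univ x)
  obtain ⟨x, -, hx⟩ : ∃ x ∈ univ, 0 < p x :=
    exists_lt_of_sum_lt (f := fun _ => 0) (by rw [hp.2, sum_const_zero]; exact one_pos)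
  exact sum_pos' (fun y _ => mul_nonneg (hp.1 y) (by linarith [hp.1 y, hdiag y]))
    ⟨x, mem_univ x, mul_pos hx (by linarith [hdiag x])⟩

theorem IsDense.dotProduct_gapMatrix_mul_lt [Nonempty V] {m : ℕ} {c : ℝ} (hD : G.IsDense m c)
    {p : V → ℝ} (hmin : IsMinOn (fun p => p ⬝ᵥ (G.gapMatrix *ᵥ p)) (stdSimplex ℝ V) p) :
    p ⬝ᵥ (G.gapMatrix *ᵥ p) * (7 * m + 9) < 14 := by
  have hcard : (0 : ℝ) < Fintype.card V := by exact_mod_cast Fintype.card_pos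
  set u : V → ℝ := fun _ => (Fintype.card V : ℝ)⁻¹
  have hu : u ∈ stdSimplex ℝ V := ⟨fun _ => (inv_pos.2 hcard).le, by simp [u, hcard.ne']⟩
  have hsum : ∑ x, c * ∑ y, (G.gap y x : ℝ) < 14 * Fintype.card V := by
    simpa [mul_comm] using
      sum_lt_sum_of_nonempty (univ_nonempty (α := V)) fun x _ => hD.sum_gap_lt x
  calc p ⬝ᵥ (G.gapMatrix *ᵥ p) * (7 * m + 9)
      ≤ u ⬝ᵥ (G.gapMatrix *ᵥ u) * (7 * m + 9) := by gcongr; exact isMinOn_iff.1 hmin u hu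
    _ = (Fintype.card V : ℝ)⁻¹ * ∑ x, c * ∑ y, (G.gap y x : ℝ) := by
        simp only [u, dotProduct, mulVec, gapMatrix, of_apply, ← sum_mul, ← mul_sum, ← hD.total,
          G.gap_comm]
        field_simp
    _ < 14 := by rwa [inv_mul_lt_iff₀ hcard, mul_comm]

theorem IsDense.exists_isBalanced [Nonempty V] {m : ℕ} {c : ℝ} (hD : G.IsDense m c) :
    ∃ K q, G.IsBalanced m K q := by
  obtain ⟨p, hp, hmin, hlt⟩ := exists_isMinOn_stdSimplex_two_mul_lt G.isSymm_gapMatrix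
  have hΦ := G.dotProduct_gapMatrix_pos hp
  refine ⟨({x | p x ≠ 0} : Finset V), fun x => p x / (p ⬝ᵥ (G.gapMatrix *ᵥ p)), ?_, ?_, ?_, ?_⟩
  · exact fun x hx => div_pos ((hp.1 x).lt_of_ne' (by simpa using hx)) hΦ
  · intro x hx y hy hxy
    have hgap := hlt x y hxy (by simpa using hx) (by simpa using hy)
    simp only [gapMatrix, of_apply, gap_self] at hgap
    norm_cast at hgap
    have := G.gap_add_w x y
    omega
  · intro x hx
    simp only [mul_div_assoc']
    rw [← sum_div, ← gapMatrix_mulVec_apply, mulVec_eq_dotProduct_of_isMinOn_stdSimplex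
      G.isSymm_gapMatrix hp hmin (by simpa using hx), div_self hΦ.ne']
  · rw [← sum_div, sum_filter_ne_zero, hp.2, lt_div_iff₀ hΦ]
    linarith [hD.dotProduct_gapMatrix_mul_lt hmin]

end Lagrangian

/-! ### Homomorphisms to `RK_r⁻` -/

section RedCliqueMinus

variable {r : ℕ}

theorem le_redCliqueMinus_w_iff {k : ℕ} (hk : k ≤ 2) (i j : Fin r) :
    k ≤ (redCliqueMinus r).w i j ↔
      (i = j → k = 0) ∧ (i.val < 2 → j.val < 2 → k ≠ 2) := by
  simp only [redCliqueMinus]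
  split_ifs with hij hlt
  · simp only [hij, Nat.le_zero, forall_const, iff_self_and]
    omega
  · simp only [hij, hlt, false_imp_iff, true_and, forall_const]
    omega
  · simp only [hij, hk, false_imp_iff, true_and, true_iff]
    exact fun hi hj => absurd ⟨hi, hj⟩ hlt

theorem isHom_redCliqueMinus_iff {φ : V → Fin r} :
    G.IsHom (redCliqueMinus r) φ ↔ ∀ x y, (φ x = φ y → G.w x y = 0) ∧
      ((φ x).val < 2 → (φ y).val < 2 → G.w x y ≠ 2) := by
  refine forall₂_congr fun x y => ?_
  rw [← le_redCliqueMinus_w_iff (G.le_two x y)]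
  refine ⟨fun h => ?_, fun h _ => h⟩
  rcases eq_or_ne x y with rfl | hxy
  · simp only [loopless, le_refl]
  · exact h hxy

theorem hasHom_iff_exists_partition (G : ColouredGraph V) (r : ℕ) :
    G.HasHom (redCliqueMinus r) ↔ ∃ W : Fin r → Set V, G.IsMinusPartition W := by
  simp only [HasHom, isHom_redCliqueMinus_iff]
  constructor
  · rintro ⟨φ, hφ⟩
    refine ⟨fun i => φ ⁻¹' {i}, fun i j hij => ?_, ?_, fun i x hx y hy _ => ?_,
      fun i j hi hj x hx y hy => ?_⟩
    · exact Disjoint.preimage φ (Set.disjoint_singleton.2 hij)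
    · rw [← Set.preimage_iUnion, Set.iUnion_singleton_eq_range, Set.range_id', Set.preimage_univ]
    · exact (hφ x y).1 (hx.trans hy.symm)
    · rw [Set.mem_preimage, Set.mem_singleton_iff] at hx hy
      exact (hφ x y).2 (by omega) (by omega)
  · rintro ⟨W, -, hcover, hgreen, hblue⟩
    choose φ hφ using fun v => Set.mem_iUnion.1 (hcover ▸ Set.mem_univ v)
    have green (x y) (hxy : φ x = φ y) : G.w x y = 0 := by
      rcases eq_or_ne x y with rfl | hne
      · exact G.loopless x
      · exact hgreen (φ x) x (hφ x) y (hxy ▸ hφ y) hne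
    refine ⟨φ, fun x y => ⟨green x y, fun hx hy => ?_⟩⟩
    obtain heq | ⟨hx, hy⟩ | ⟨hx, hy⟩ : φ x = φ y ∨
        ((φ x).val = 0 ∧ (φ y).val = 1) ∨ (φ y).val = 0 ∧ (φ x).val = 1 := by omega
    · rw [green x y heq]
      exact two_ne_zero.symm
    · exact hblue _ _ hx hy x (hφ x) y (hφ y)
    · exact G.symm x y ▸ hblue _ _ hx hy y (hφ y) x (hφ x)

theorem hasHom_redCliqueMinus_of_colouring {m : ℕ} {φ : V → Bool ⊕ Fin m}
    (hφ : ∀ x y, (φ x = φ y → G.w x y = 0) ∧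
      ((φ x).isLeft → (φ y).isLeft → G.w x y ≠ 2)) :
    G.HasHom (redCliqueMinus (2 + m)) := by
  let ψ : Bool ⊕ Fin m ≃ Fin (2 + m) :=
    (finTwoEquiv.symm.sumCongr (Equiv.refl _)).trans finSumFinEquiv
  have isLeft_of_lt : ∀ s, (ψ s).val < 2 → s.isLeft := by
    rintro (b | i) hs
    · rfl
    · simp only [ψ, Equiv.trans_apply, Equiv.sumCongr_apply, Sum.map_inr,
        finSumFinEquiv_apply_right, Fin.val_natAdd] at hs
      omega
  exact ⟨ψ ∘ φ, isHom_redCliqueMinus_iff.2 fun x y => ⟨fun h => (hφ x y).1 (ψ.injective h),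
    fun hx hy => (hφ x y).2 (isLeft_of_lt _ hx) (isLeft_of_lt _ hy)⟩⟩

theorem Frame.val_lt_two_iff_isLeft {ι : Type*} [Fintype ι] (K : Frame G ι)
    (hr : Fintype.card ι + 2 = r) {φ : V → Fin r} (hφ : G.IsHom (redCliqueMinus r) φ)
    (k : Bool ⊕ ι) : (φ (K k)).val < 2 ↔ k.isLeft := by
  classical
  rw [isHom_redCliqueMinus_iff] at hφ
  have hinj : Function.Injective (φ ∘ K) := fun k l hkl => by
    by_contra hne
    have hgreen := (hφ (K k) (K l)).1 hkl
    rw [K.w_eq k l hne] at hgreen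
    exact Nat.one_le_iff_ne_zero.1 (pairWeight_pos k l) hgreen
  have hbij : Function.Bijective (φ ∘ K) := (Fintype.bijective_iff_injective_and_card _).2
    ⟨hinj, by rw [Fintype.card_sum, Fintype.card_bool, Fintype.card_fin]; omega⟩
  let A : Finset (Bool ⊕ ι) := {k | (φ (K k)).val < 2}
  have hA : #A = 2 := by
    have := card_bijective (s := A) (t := {i : Fin r | i.val < 2}) _ hbij (by simp [A])
    rw [this, Fin.card_filter_val_lt]
    omega
  have hsub : A ⊆ univ.filter fun k => k.isLeft := fun k hk => by
    obtain ⟨l, hl, hlk⟩ := exists_mem_ne (hA ▸ one_lt_two) k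
    have hblue := (hφ (K k) (K l)).2 (by simpa [A] using hk) (by simpa [A] using hl)
    rw [K.w_eq k l hlk.symm, pairWeight] at hblue
    simp_all
  have hleft : #(univ.filter fun k : Bool ⊕ ι => k.isLeft) = 2 := by
    rw [card_filter, Fintype.sum_sum_type]
    simp
  have := eq_of_subset_of_card_le hsub (by rw [hA, hleft])
  simpa [A] using Finset.ext_iff.1 this k

end RedCliqueMinus

section UpperBound

variable [Fintype V]

theorem minDegree_le (G : ColouredGraph V) (v : V) : G.minDegree ≤ G.degree v :=
  ciInf_le (OrderBot.bddBelow _) v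

theorem sum_gap_add_degree (G : ColouredGraph V) (v : V) :
    ∑ u, G.gap u v + G.degree v = 2 * Fintype.card V := by
  simp only [degree, G.gap_comm _ v, ← sum_add_distrib, gap_add_w]
  rw [sum_const, card_univ, smul_eq_mul, mul_comm]

theorem isDense_of_minDegree [Nonempty V] {m : ℕ} (hG : G.CliqueBound (2 * m + 4))
    (h : (14 * (m : ℝ) + 4) / (7 * m + 9) * Fintype.card V < G.minDegree) :
    G.IsDense m ((7 * m + 9) / Fintype.card V) where
  pos := by have := Fintype.card_pos (α := V); positivity
  total := by field_simp
  sum_gap_lt v := by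
    have hdegree : (G.minDegree : ℝ) ≤ G.degree v := Nat.cast_le.2 (G.minDegree_le v)
    have hsum : ∑ u, (G.gap u v : ℝ) + G.degree v = 2 * Fintype.card V := by
      exact_mod_cast G.sum_gap_add_degree v
    rw [div_mul_eq_mul_div, div_lt_iff₀ (by positivity)] at h
    rw [div_mul_eq_mul_div, div_lt_iff₀ (by exact_mod_cast Fintype.card_pos)]
    nlinarith
  cliqueBound := hG

theorem hasHom_redCliqueMinus_of_minDegree {r : ℕ} (hr : 2 ≤ r)
    (hG : G.FamilyFree (family (2 * r)))
    (h : (14 * (r : ℝ) - 24) / (7 * r - 5) * Fintype.card V < G.minDegree) :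
    G.HasHom (redCliqueMinus r) := by
  classical
  rcases isEmpty_or_nonempty V with hV | hV
  · exact ⟨hV.elim, hV.elim⟩
  obtain ⟨m, rfl⟩ := Nat.exists_eq_add_of_le hr
  have hbound : G.CliqueBound (2 * m + 4) := by
    convert (familyFree_family_iff_cliqueBound (by omega)).1 hG using 1
    ring
  have hD : G.IsDense m ((7 * m + 9) / Fintype.card V) := by
    refine isDense_of_minDegree hbound ?_
    convert h using 3 <;> push_cast <;> ring
  obtain ⟨Q, q, hq⟩ := hD.exists_isBalanced
  obtain ⟨K⟩ := hq.nonempty_frame hbound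
  obtain ⟨φ, hφ⟩ := IsDense.exists_colouring (by rwa [Fintype.card_fin]) K
  exact hasHom_redCliqueMinus_of_colouring hφ

end UpperBound

/-! ### The extremal graphs -/

section BlowUp

variable {L : Type*} {H : ColouredGraph L} {f : V → L}

/-- The blow-up of `H` in which the vertex `l` is replaced by the green class `f ⁻¹' {l}`. -/
def blowUp (H : ColouredGraph L) (f : V → L) : ColouredGraph V where
  w x y := H.w (f x) (f y)
  symm _ _ := H.symm _ _
  loopless _ := H.loopless _
  le_two _ _ := H.le_two _ _

theorem HasHom.of_blowUp {U : Type*} {F : ColouredGraph U} (hf : f.Surjective)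
    (h : (H.blowUp f).HasHom F) : H.HasHom F := by
  obtain ⟨φ, hφ⟩ := h
  obtain ⟨g, hg⟩ := hf.hasRightInverse
  refine ⟨φ ∘ g, fun x y hxy => ?_⟩
  simpa only [blowUp, Function.comp_apply, hg x, hg y] using hφ (g x) (g y) (hg.injective.ne hxy)

theorem IsClique.card_le_of_colouring {κ : Type*} [Fintype κ] {k : ℕ} {Q : Finset V}
    (hQ : G.IsClique k Q) {χ : V → κ} (hχ : ∀ x y, χ x = χ y → G.w x y < k) :
    #Q ≤ Fintype.card κ :=
  card_le_card_of_injOn χ (fun _ _ => mem_univ _) fun x hx y hy hxy => by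
    by_contra hne
    exact (hχ x y hxy).not_ge (hQ hx hy hne)

theorem minDegree_eq_of_forall_degree_eq [Fintype V] [Nonempty V] {d : ℕ}
    (h : ∀ x, G.degree x = d) : G.minDegree = d := by
  simp only [minDegree, h, ciInf_const]

end BlowUp

section Extremal

variable {s : ℕ}

/-- The colours between the four exceptional classes of the extremal graph. -/
def coreWeight : Fin 4 → Fin 4 → ℕ :=
  ![![0, 0, 1, 2], ![0, 0, 2, 1], ![1, 2, 0, 2], ![2, 1, 2, 0]]

theorem coreWeight_comm : ∀ i j, coreWeight i j = coreWeight j i := by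
  decide

/-- The reduced extremal graph for `r = s + 3`: four vertices coloured by `coreWeight` and `s`
further vertices whose edges are all red. -/
def pattern (s : ℕ) : ColouredGraph (Fin 4 ⊕ Fin s) where
  w
    | .inl i, .inl j => coreWeight i j
    | .inr i, .inr j => if i = j then 0 else 2
    | _, _ => 2
  symm := by
    rintro (i | i) (j | j)
    · exact coreWeight_comm i j
    · rfl
    · rfl
    · simp only [eq_comm]
  loopless := by
    rintro (i | i)
    · exact (by decide : ∀ i, coreWeight i i = 0) i
    · exact if_pos rfl
  le_two := by
    rintro (i | i) (j | j)
    · exact (by decide : ∀ i j, coreWeight i j ≤ 2) i j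
    · rfl
    · rfl
    · dsimp only
      split_ifs <;> omega

theorem pattern_w_lt_of_map_eq {κ : Type*} {g : Fin 4 → κ} {k : ℕ} (hk : 0 < k)
    (hg : ∀ i j, g i = g j → coreWeight i j < k) {x y : Fin 4 ⊕ Fin s}
    (h : Sum.map g id x = Sum.map g id y) : (pattern s).w x y < k := by
  rcases x with i | i <;> rcases y with j | j
  · exact hg i j (Sum.inl.inj h)
  · exact absurd h Sum.inl_ne_inr
  · exact absurd h Sum.inr_ne_inl
  · rwa [show i = j from Sum.inr.inj h, (pattern s).loopless]

theorem cliqueBound_blowUp_pattern (f : V → Fin 4 ⊕ Fin s) :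
    ((pattern s).blowUp f).CliqueBound (2 * (s + 3)) := by
  intro Q R _ _ hQ hR
  have hQcard := hQ.card_le_of_colouring (χ := Sum.map (![0, 0, 1, 2] : Fin 4 → Fin 3) id ∘ f)
    fun _ _ => pattern_w_lt_of_map_eq one_pos (by decide)
  have hRcard := hR.card_le_of_colouring (χ := Sum.map (![0, 1, 0, 1] : Fin 4 → Fin 2) id ∘ f)
    fun _ _ => pattern_w_lt_of_map_eq two_pos (by decide)
  simp only [Fintype.card_sum, Fintype.card_fin] at hQcard hRcard
  omega

/-- The copy of `RK_r⁻` in `pattern s` on the core vertices `a`, `b`, `c` and all vertices outside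
the core, with blue edge `ab`. -/
def coreFrame (s : ℕ) (a b c : Fin 4) (hab : coreWeight a b = 1) (hac : coreWeight a c = 2)
    (hbc : coreWeight b c = 2) : Frame (pattern s) (Option (Fin s)) :=
  .ofRed (Sum.elim (fun t => .inl (cond t b a)) fun o => o.elim (.inl c) .inr) false
    (by
      have hcb : coreWeight c b = 2 := (coreWeight_comm c b).trans hbc
      rintro ((_ | _) | _ | i) ((_ | _) | _ | j) hkl hk hl <;> simp_all [pattern])
    (by rintro ((_ | _) | _ | i) hk <;> simp_all [pattern, pairWeight])

theorem not_hasHom_pattern (s : ℕ) : ¬ (pattern s).HasHom (redCliqueMinus (s + 3)) := by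
  rintro ⟨φ, hφ⟩
  have hcard : Fintype.card (Option (Fin s)) + 2 = s + 3 := by
    rw [Fintype.card_option, Fintype.card_fin]
  -- Core vertex `3` lies on the blue edge of only one of two copies of `RK_r⁻`.
  have hright := (coreFrame s 0 2 3 rfl rfl rfl).val_lt_two_iff_isLeft hcard hφ (.inr none)
  have hleft := (coreFrame s 1 3 2 rfl rfl rfl).val_lt_two_iff_isLeft hcard hφ (.inl true)
  exact Bool.false_ne_true (hright.1 (hleft.2 rfl))

/-- The relative sizes of the classes of the extremal graph. -/
def classSize : Fin 4 ⊕ Fin s → ℕ := Sum.elim ![2, 2, 6, 6] fun _ => 7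

theorem classSize_pos (l : Fin 4 ⊕ Fin s) : 0 < classSize l := by
  rcases l with i | _
  · exact (by decide : ∀ i, 0 < (![2, 2, 6, 6] : Fin 4 → ℕ) i) i
  · exact Nat.succ_pos 6

theorem sum_classSize (s : ℕ) : ∑ l : Fin 4 ⊕ Fin s, classSize l = 7 * s + 16 := by
  have hcore : ∑ i, (![2, 2, 6, 6] : Fin 4 → ℕ) i = 16 := by decide
  simp only [Fintype.sum_sum_type, classSize, Sum.elim_inl, Sum.elim_inr, hcore, sum_const,
    card_univ, Fintype.card_fin, smul_eq_mul]
  ring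

theorem sum_classSize_mul_pattern_w (l : Fin 4 ⊕ Fin s) :
    ∑ l', classSize l' * (pattern s).w l l' = 14 * s + 18 := by
  rw [Fintype.sum_sum_type]
  rcases l with i | i
  · have hcore : ∀ i, ∑ j, (![2, 2, 6, 6] : Fin 4 → ℕ) j * coreWeight i j = 18 := by decide
    simp only [classSize, pattern, Sum.elim_inl, Sum.elim_inr, hcore, sum_const, card_univ,
      Fintype.card_fin, smul_eq_mul]
    ring
  · have hcore : ∑ j, (![2, 2, 6, 6] : Fin 4 → ℕ) j = 16 := by decide
    have hrest : ∑ j, (if i = j then 0 else 2) + 2 = 2 * s := by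
      rw [← add_sum_erase _ _ (mem_univ i), if_pos rfl, sum_congr rfl fun j hj =>
        if_neg (ne_of_mem_erase hj).symm, sum_const, card_erase_of_mem (mem_univ i), card_univ,
        Fintype.card_fin, smul_eq_mul]
      have := i.isLt
      omega
    simp only [classSize, pattern, Sum.elim_inl, Sum.elim_inr, ← mul_sum, ← sum_mul, hcore]
    omega

theorem exists_extremal (s : ℕ) {k : ℕ} (hk : 0 < k) :
    ∃ G : ColouredGraph (Fin (k * (7 * s + 16))),
      G.FamilyFree (family (2 * (s + 3))) ∧ G.minDegree = k * (14 * s + 18) ∧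
        ¬ G.HasHom (redCliqueMinus (s + 3)) := by
  have hcard : Fintype.card (Fin (k * (7 * s + 16))) =
      Fintype.card (Σ l : Fin 4 ⊕ Fin s, Fin (k * classSize l)) := by
    simp only [Fintype.card_sigma, Fintype.card_fin, ← mul_sum, sum_classSize]
  let e := Fintype.equivOfCardEq hcard
  let f : Fin (k * (7 * s + 16)) → Fin 4 ⊕ Fin s := fun x => (e x).1
  have hf : f.Surjective := fun l =>
    ⟨e.symm ⟨l, ⟨0, Nat.mul_pos hk (classSize_pos l)⟩⟩, by simp only [f, Equiv.apply_symm_apply]⟩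
  refine ⟨(pattern s).blowUp f,
    (familyFree_family_iff_cliqueBound (by omega)).2 (cliqueBound_blowUp_pattern f), ?_,
    fun h => not_hasHom_pattern s (h.of_blowUp hf)⟩
  have : Nonempty (Fin (k * (7 * s + 16))) := ⟨⟨0, by positivity⟩⟩
  refine minDegree_eq_of_forall_degree_eq fun x => ?_
  calc ∑ y, (pattern s).w (f x) (e y).1
      = ∑ y : Σ l : Fin 4 ⊕ Fin s, Fin (k * classSize l), (pattern s).w (f x) y.1 :=
        e.sum_comp fun y => (pattern s).w (f x) y.1
    _ = k * ∑ l, classSize l * (pattern s).w (f x) l := by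
        simp only [Fintype.sum_sigma, sum_const, card_univ, Fintype.card_fin, smul_eq_mul, mul_sum,
          mul_assoc]
    _ = k * (14 * s + 18) := by rw [sum_classSize_mul_pattern_w]

theorem exists_minDegree_eq_not_hasHom {r : ℕ} (hr : 3 ≤ r) {n : ℕ} (hn : 0 < n)
    (hdvd : 7 * r - 5 ∣ n) :
    ∃ G : ColouredGraph (Fin n), G.FamilyFree (family (2 * r)) ∧
      (G.minDegree : ℝ) = (14 * (r : ℝ) - 24) / (7 * (r : ℝ) - 5) * (n : ℝ) ∧
      ¬ G.HasHom (redCliqueMinus r) := by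
  obtain ⟨s, rfl⟩ := Nat.exists_eq_add_of_le' hr
  obtain ⟨k, rfl⟩ := hdvd
  rw [show (7 * (s + 3) - 5) * k = k * (7 * s + 16) by
    rw [mul_comm, show 7 * (s + 3) - 5 = 7 * s + 16 by omega]]
  obtain ⟨G, hfree, hdegree, hhom⟩ := exists_extremal s (Nat.pos_of_mul_pos_left hn)
  refine ⟨G, hfree, ?_, hhom⟩
  rw [hdegree]
  have hden : (7 * ((s + 3 : ℕ) : ℝ) - 5) = 7 * s + 16 := by push_cast; ring
  rw [hden]
  push_cast
  field_simp
  ring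

end Extremal

end ColouredGraph

theorem theorem1p6 (r : ℕ) (hr : 3 ≤ r) :
    -- the minimum degree condition forces a homomorphism to `RK_r⁻`
    (∀ (V : Type*) [Fintype V] (G : ColouredGraph V),
      G.FamilyFree (ColouredGraph.family (2 * r)) →
      (14 * (r : ℝ) - 24) / (7 * (r : ℝ) - 5) * (Fintype.card V : ℝ) < (G.minDegree : ℝ) →
        G.HasHom (ColouredGraph.redCliqueMinus r) ∧
        ∃ W : Fin r → Set V, G.IsMinusPartition W) ∧
    -- homomorphisms to `RK_r⁻` and partitions are equivalent for every coloured graph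
    (∀ (V : Type*) [Fintype V] (G : ColouredGraph V),
      G.HasHom (ColouredGraph.redCliqueMinus r) ↔
        ∃ W : Fin r → Set V, G.IsMinusPartition W) ∧
    -- for every positive multiple `n` of `7r - 5`, strict inequality cannot be relaxed
    (∀ n : ℕ, 0 < n → (7 * r - 5) ∣ n →
      ∃ G : ColouredGraph (Fin n),
        G.FamilyFree (ColouredGraph.family (2 * r)) ∧
        (G.minDegree : ℝ) = (14 * (r : ℝ) - 24) / (7 * (r : ℝ) - 5) * (n : ℝ) ∧
        ¬ G.HasHom (ColouredGraph.redCliqueMinus r)) ∧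
    -- the constant is the least possible one
    IsLeast {α : ℝ | ∀ (n : ℕ) (G : ColouredGraph (Fin n)),
        G.FamilyFree (ColouredGraph.family (2 * r)) →
        α * (n : ℝ) < (G.minDegree : ℝ) →
        G.HasHom (ColouredGraph.redCliqueMinus r)}
      ((14 * (r : ℝ) - 24) / (7 * (r : ℝ) - 5)) := by
  refine ⟨fun V _ G hG hdegree => ?_, fun V _ G => G.hasHom_iff_exists_partition r,
    fun n hn hdvd => ColouredGraph.exists_minDegree_eq_not_hasHom hr hn hdvd,
    fun n G hG hdegree => ?_, fun α hα => ?_⟩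
  · have hhom := ColouredGraph.hasHom_redCliqueMinus_of_minDegree (by omega) hG hdegree
    exact ⟨hhom, (G.hasHom_iff_exists_partition r).1 hhom⟩
  · exact ColouredGraph.hasHom_redCliqueMinus_of_minDegree (by omega) hG
      (by rwa [Fintype.card_fin])
  · have hn : 0 < 7 * r - 5 := by omega
    by_contra! hlt
    obtain ⟨G, hfree, hdegree, hhom⟩ :=
      ColouredGraph.exists_minDegree_eq_not_hasHom hr hn dvd_rfl
    refine hhom (hα _ G hfree ?_)
    rw [hdegree]
    exact mul_lt_mul_of_pos_right hlt (Nat.cast_pos.2 hn)
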